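/- Let $(\mathcal X,\mathcal B_{\mathcal X})$ and $(\mathcal Y_i,\mathcal B_i)$, $i=1,\dots,M$, be non-empty measurable spaces with countably generated $\sigma$-algebras, let $\mathcal Y=\mathcal Y_1\times\dots\times\mathcal Y_M$, and let $(X^t,Y^t)_{t\ge 0}$, $Y^t=(Y^t_1,\dots,Y^t_M)$, be a time-homogeneous Markov chain on $\mathcal X\times\mathcal Y$; write $\mathbf P_{x,y},\mathbf E_{x,y}$ for probability and expectation when the chain starts from $(x,y)$. Let $L_{2,i}:\mathcal Y_i\to[0,\infty)$ be measurable functions. Assume that $\{X^t\}$ has autonomous dynamics (the law of $X^1$ under $\mathbf P_{x,y}$ does not depend on $y$), so that it is itself a Markov chain, with laws $\mathbf P_x$; that $\{X^t\}$ is aperiodic; and that there is a set $V\in\mathcal B_{\mathcal X}$ such that, with $\tau=\min\{t\ge1:X^t\in V\}$, $$\mathbf P_x(\tau<\infty)=1\ \text{ for all } x\in\mathcal X,\qquad \sup_{x\in V}\mathbf E_x\tau<\infty,$$ and such that, for some $0<p\le1$, some probability measure $\mu$ and some integer $m\ge1$, $\mathbf P_x(X^m\in B)\ge p\,\mu(B)$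 for all $x\in V$ and $B\in\mathcal B_{\mathcal X}$. Let $\pi$ be the stationary distribution of $\{X^t\}$. Suppose that the following condition $\widehat B$ holds: for each $i$ there exist a non-negative, non-increasing function $h_i$ on $[0,\infty)$ with $h_i(N)\downarrow0$ as $N\to\infty$ and a family of mutually independent random variables $\{\varphi^t_{x,i}\}$, $x\in\mathcal X$, $t=0,1,\dots$, such that (i) for each $t$ and $i$ the random variables $\varphi^t_{x,i}$, $x\in\mathcal X$, are uniformly integrable; (ii) for each $i$ and $x$ the random variables $\varphi^t_{x,i}$, $t=0,1,\dots$, are identically distributed with a common distribution function $F_{x,i}$, and $x\mapsto F_{x,i}(r)$ is measurable for every $r\in\mathbb R$; moreover $\varphi^t_{\cdot,i}$ is sampled independently of the past, in the sense that $\varphi^t_{X^t,i}$ is a random variable whose conditional distribution given $X^0,\dots,X^t$ and $\varphi^0_{X^0,i},\dots,\varphi^{t-1}_{X^{t-1},i}$ is $F_{X^t,i}$; (iii) for all $x\in\mathcal X$, $y\in\mathcal Y$ and $t=0,1,\dots$, $$L_{2,i}(Y_i^{t+1})-L_{2,i}(Y_i^t)\le\varphi^t_{X^t,i}+h_i\bigl(L_{2,i}(Y^t_i)\bigr)\quad\mathbf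 P_{x,y}\text{-a.s.};$$ (iv) the functions $f_i(x)=\mathbf E\varphi^1_{x,i}$ satisfy $\int_{\mathcal X}f_i(x)\,\pi(dx)<0$. Then condition $\widetilde B3$ holds: for each $i$, the expectations below are finite and $$\sup_{t\ge N}\ \sup_{y\in\mathcal Y,\,x\in V}\frac{\mathbf E_{x,y}\bigl(L_{2,i}(Y^t_i)-L_{2,i}(y_i)\bigr)}{t}\to0\qquad\text{as }N\to\infty .$$ -/

import Mathlib

open MeasureTheory ProbabilityTheory Filter Topology
open scoped ENNReal

/-- `(Ω, P z, Z)` is a time-homogeneous Markov chain with transition kernel `κ`; under `P z` it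
starts from `z`, and the Markov property holds with respect to its own past. -/
structure IsMarkovFamily {S Ω : Type*} [MeasurableSpace S] [MeasurableSpace Ω]
    (κ : Kernel S S) (P : S → Measure Ω) (Z : ℕ → Ω → S) : Prop where
  isProbability : ∀ z, IsProbabilityMeasure (P z)
  measurable : ∀ t, Measurable (Z t)
  start : ∀ z, (P z).map (Z 0) = Measure.dirac z
  markov : ∀ z t (A : Set Ω) (B : Set S),
    MeasurableSet[⨆ s ≤ t, MeasurableSpace.comap (Z s) inferInstance] A → MeasurableSet B →
    P z (A ∩ Z (t + 1) ⁻¹' B) = ∫⁻ ω in A, κ (Z t ω) B ∂(P z)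

/-- Absence of cycles: there is no `d ≥ 2` and no pairwise disjoint nonempty measurable sets
`D 0, …, D (d - 1)` that the chain visits cyclically with probability one.  For a chain with a
recurrent petite set, the complement of the union of such sets (an absorbing set) is
automatically null for the maximal irreducibility measure, so that this is the usual
aperiodicity of an irreducible chain. -/
def IsAperiodic {S : Type*} [MeasurableSpace S] (Q : Kernel S S) : Prop :=
  ¬ ∃ (d : ℕ) (D : ZMod d → Set S), 2 ≤ d ∧ (∀ k, MeasurableSet (D k)) ∧
    (∀ k, (D k).Nonempty) ∧ (∀ k l, k ≠ l → Disjoint (D k) (D l)) ∧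
    ∀ k, ∀ x ∈ D k, Q x (D (k + 1)) = 1

/-- `τ(V) = min {t ≥ 1 : X t ∈ V}`, equal to `⊤` if there is no such `t`. -/
noncomputable def returnTime {S Ω : Type*} (X : ℕ → Ω → S) (V : Set S) (ω : Ω) : ℕ∞ :=
  ⨅ t : ℕ, ⨅ _ : 1 ≤ t ∧ X t ω ∈ V, (t : ℕ∞)

/-- The assumptions on the first component: it is autonomous with transition kernel `Q`,
aperiodic, and `V` is a positive recurrent petite set for it.  By `autonomous`, the law of `X`
under `P (x, y)` does not depend on `y`: it is the law of the first component started from `x`. -/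
structure ConditionA {𝒳 𝒴 Ω : Type*} [MeasurableSpace 𝒳] [MeasurableSpace 𝒴]
    [MeasurableSpace Ω] (κ : Kernel (𝒳 × 𝒴) (𝒳 × 𝒴)) (Q : Kernel 𝒳 𝒳)
    (P : 𝒳 × 𝒴 → Measure Ω) (X : ℕ → Ω → 𝒳) (V : Set 𝒳) : Prop where
  autonomous : ∀ x y, (κ (x, y)).map Prod.fst = Q x
  aperiodic : IsAperiodic Q
  measurableSet : MeasurableSet V
  recurrent : ∀ x y, ∀ᵐ ω ∂(P (x, y)), returnTime X V ω < ⊤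
  positive : ⨆ x ∈ V, ⨆ y, ∫⁻ ω, (returnTime X V ω : ℝ≥0∞) ∂(P (x, y)) < ⊤
  petite : ∃ (p : ℝ) (μ : Measure 𝒳) (m : ℕ), 0 < p ∧ p ≤ 1 ∧ IsProbabilityMeasure μ ∧ 1 ≤ m ∧
    ∀ x ∈ V, ∀ y, ∀ B, MeasurableSet B → ENNReal.ofReal p * μ B ≤ P (x, y) (X m ⁻¹' B)

/-- The sigma-algebra generated by `X 0, …, X t` and `ξ 0, …, ξ (t - 1)`. -/
abbrev pastSigma {S Ω : Type*} [MeasurableSpace S] (X : ℕ → Ω → S) (ξ : ℕ → Ω → ℝ) (t : ℕ) :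
    MeasurableSpace Ω :=
  (⨆ s ≤ t, MeasurableSpace.comap (X s) inferInstance) ⊔
    (⨆ s < t, MeasurableSpace.comap (ξ s) inferInstance)

/-- One coordinate of the domination condition.  The process `ℓ t` is the value of the test
function at time `t`, `φ t x` is the dominating family, and `F x` is the distribution
of `φ t x`. -/
structure IsDominated {𝒳 S Ω : Type*} [MeasurableSpace 𝒳] [MeasurableSpace Ω]
    (P : S → Measure Ω) (X : ℕ → Ω → 𝒳) (π : Measure 𝒳) (ℓ : ℕ → Ω → ℝ)
    (h : ℝ → ℝ) (φ : ℕ → 𝒳 → Ω → ℝ) (F : 𝒳 → Measure ℝ) : Prop where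
  h_nonneg : ∀ N, 0 ≤ N → 0 ≤ h N
  h_antitone : AntitoneOn h (Set.Ici 0)
  h_tendsto : Tendsto h atTop (𝓝 0)
  measurable : ∀ t x, Measurable (φ t x)
  /-- all the variables `φ t x` are mutually independent -/
  indep : ∀ z, iIndepFun (fun q : ℕ × 𝒳 => φ q.1 q.2) (P z)
  /-- for each `t`, the variables `φ t x`, `x ∈ 𝒳`, are uniformly integrable -/
  unifIntegrable : ∀ z t, UniformIntegrable (φ t) 1 (P z)
  /-- `φ t x` has the distribution `F x` for every `t` -/
  law : ∀ z t x, (P z).map (φ t x) = F x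
  /-- the distribution function of `F x` is measurable in `x` -/
  cdf_measurable : ∀ r : ℝ, Measurable fun x => F x (Set.Iic r)
  /-- `φ t (X t)` is a random variable -/
  subst_measurable : ∀ t, Measurable fun ω => φ t (X t ω) ω
  /-- the family `φ t` is sampled independently of the past: given `X 0, …, X t` and the earlier
  values `φ s (X s)`, `s < t`, the variable `φ t (X t)` has the distribution `F (X t)` -/
  subst_law : ∀ z t (A : Set Ω) (B : Set ℝ),
    MeasurableSet[pastSigma X (fun s ω => φ s (X s ω) ω) t] A → MeasurableSet B →
    P z (A ∩ {ω | φ t (X t ω) ω ∈ B}) = ∫⁻ ω in A, F (X t ω) B ∂(P z)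
  /-- the increments of the test function are dominated -/
  increment_le : ∀ z t, ∀ᵐ ω ∂(P z), ℓ (t + 1) ω - ℓ t ω ≤ φ t (X t ω) ω + h (ℓ t ω)
  /-- the means `f x` of `φ t x` have a negative average with respect to `π` -/
  drift_neg : ∫ x, (∫ r, r ∂(F x)) ∂π < 0

/-- The domination condition: every coordinate `L i (Y i)` is dominated. -/
def ConditionBHat {M : ℕ} {𝒳 Ω : Type*} {𝒴 : Fin M → Type*} [MeasurableSpace 𝒳]
    [MeasurableSpace Ω] (P : 𝒳 × (∀ i, 𝒴 i) → Measure Ω)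
    (X : ℕ → Ω → 𝒳) (Y : ℕ → Ω → ∀ i, 𝒴 i) (π : Measure 𝒳) (L : ∀ i, 𝒴 i → ℝ) : Prop :=
  ∀ i, ∃ (h : ℝ → ℝ) (φ : ℕ → 𝒳 → Ω → ℝ) (F : 𝒳 → Measure ℝ),
    IsDominated P X π (fun t ω => L i (Y t ω i)) h φ F

/-- Sublinear drift: for each `i`, the expectations of `L i (Y t i)` from starting points in
`V × 𝒴` are finite, and
`sup_{t ≥ N} sup_{x ∈ V, y} E_{x,y} (L i (Y t i) - L i (y i)) / t → 0` as `N → ∞`;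
the suprema are taken in the extended reals. -/
def ConditionB3 {M : ℕ} {𝒳 Ω : Type*} {𝒴 : Fin M → Type*}
    [MeasurableSpace Ω] (P : 𝒳 × (∀ i, 𝒴 i) → Measure Ω)
    (Y : ℕ → Ω → ∀ i, 𝒴 i) (V : Set 𝒳) (L : ∀ i, 𝒴 i → ℝ) : Prop :=
  ∀ i,
    (∀ x ∈ V, ∀ y t, Integrable (fun ω => L i (Y t ω i)) (P (x, y))) ∧
    Tendsto (fun N : ℕ => ⨆ t ≥ N, ⨆ y : ∀ i, 𝒴 i, ⨆ x ∈ V,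
        (((∫ ω, (L i (Y t ω i) - L i (y i)) ∂(P (x, y))) / (t : ℝ) : ℝ) : EReal))
      atTop (𝓝 0)

/-! Fix a coordinate and write `ℓ t` for the test function at time `t` and `ξ t` for the sampled
variable `φ t (X t)`. Choose `R` with `h R ≤ δ`. Since its last visit to `[0, R]`, the process `ℓ`
has gained at most `ξ u + δ` at each step, so `ℓ t - ℓ 0` is at most a constant plus the sum of `ξ u
+ δ` over `s ≤ u < t`, for some random `s` (`exists_le_sum_Ico`). By uniform integrability `ξ` may
be truncated at a cost of `δ` per step in `L¹`, and the truncated variables have stationary mean at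
most `δ`. Being bounded, they let the random `s` be replaced by finitely many deterministic times
(`sum_Ico_le_blocks`). What remains is an `L¹` law of large numbers at these times, uniform over
starting points in `V` (`integral_abs_sum_le`).

That law splits the deviation into orthogonal martingale differences and a sum of `g (X u)` with `g`
bounded and `π`-centred. The second moment of the latter is a sum of correlations of `g` with its
potential sums `G n = g + Q g + ⋯ + Q ^ (n - 1) g`, so `G n` must be shown to be `o(n)` in a
suitable sense.

Here `G n - Q (G n)` is bounded by `2 c` for every `n`. A function with bounded defect is controlled
by its values on `V` and the entrance time of `V`, and the minorization on `V` bounds its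
oscillation there by a contraction argument (`abs_le_of_mem`). Integration against `π` determines
the remaining constant. The outcome, `abs_potentialSum_le`, has an error term `n` times the
probability of avoiding `V` up to a fixed time `N`. This is not uniformly small in the starting
point, but a second application of the same estimate, to that probability itself, makes it small on
average along the chain. -/

/-! ### Bounded measurable functions and the action of a kernel on them -/

/-- `g` is measurable and bounded by `c` in absolute value. -/
structure BddMeas {S : Type*} [MeasurableSpace S] (g : S → ℝ) (c : ℝ) : Prop where
  meas : Measurable g
  abs_le : ∀ x, |g x| ≤ c

namespace BddMeas

variable {S S' : Type*} [MeasurableSpace S] [MeasurableSpace S'] {g g' : S → ℝ} {c c' : ℝ}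

lemma integrable (h : BddMeas g c) (μ : Measure S) [IsFiniteMeasure μ] : Integrable g μ :=
  Integrable.of_bound h.meas.aestronglyMeasurable c (ae_of_all _ h.abs_le)

lemma mono (h : BddMeas g c) (hc : c ≤ c') : BddMeas g c' :=
  ⟨h.meas, fun x => (h.abs_le x).trans hc⟩

lemma add (h : BddMeas g c) (h' : BddMeas g' c') : BddMeas (fun x => g x + g' x) (c + c') :=
  ⟨h.meas.add h'.meas, fun x => (abs_add_le _ _).trans (add_le_add (h.abs_le x) (h'.abs_le x))⟩

lemma sub (h : BddMeas g c) (h' : BddMeas g' c') : BddMeas (fun x => g x - g' x) (c + c') :=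
  ⟨h.meas.sub h'.meas, fun x => (abs_sub _ _).trans (add_le_add (h.abs_le x) (h'.abs_le x))⟩

lemma mul (h : BddMeas g c) (h' : BddMeas g' c') : BddMeas (fun x => g x * g' x) (c * c') :=
  ⟨h.meas.mul h'.meas, fun x => by
    rw [abs_mul]
    exact mul_le_mul (h.abs_le x) (h'.abs_le x) (abs_nonneg _) ((abs_nonneg _).trans (h.abs_le x))⟩

lemma const (a : ℝ) : BddMeas (fun _ : S => a) |a| := ⟨measurable_const, fun _ => le_rfl⟩

lemma abs (h : BddMeas g c) : BddMeas (fun x => |g x|) c :=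
  ⟨h.meas.abs, fun x => by simpa using h.abs_le x⟩

lemma sum {ι : Type*} (s : Finset ι) {g : ι → S → ℝ} {c : ι → ℝ}
    (h : ∀ i, BddMeas (g i) (c i)) : BddMeas (fun x => ∑ i ∈ s, g i x) (∑ i ∈ s, c i) :=
  ⟨Finset.measurable_fun_sum s fun i _ => (h i).meas, fun x =>
    (Finset.abs_sum_le_sum_abs _ _).trans (Finset.sum_le_sum fun i _ => (h i).abs_le x)⟩

lemma comp (h : BddMeas g c) {X : S' → S} (hX : Measurable X) :
    BddMeas (fun ω => g (X ω)) c :=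
  ⟨h.meas.comp hX, fun ω => h.abs_le (X ω)⟩

lemma abs_integral_le (h : BddMeas g c) (μ : Measure S) [IsProbabilityMeasure μ] :
    |∫ x, g x ∂μ| ≤ c := by
  have := norm_integral_le_of_norm_le_const (μ := μ) (f := g) (C := c) (ae_of_all _ h.abs_le)
  simpa using this

end BddMeas

/-- The action of a kernel on functions. -/
noncomputable def transfer {S S' : Type*} [MeasurableSpace S] [MeasurableSpace S']
    (K : Kernel S S') (g : S' → ℝ) (x : S) : ℝ := ∫ y, g y ∂(K x)

section Transfer

variable {S S' : Type*} [MeasurableSpace S] [MeasurableSpace S'] {g g' : S → ℝ} {c c' : ℝ}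

lemma BddMeas.transfer {g : S' → ℝ} (K : Kernel S S') [IsMarkovKernel K] (h : BddMeas g c) :
    BddMeas (transfer K g) c :=
  ⟨(h.meas.stronglyMeasurable.integral_kernel).measurable, fun x => h.abs_integral_le (K x)⟩

variable (Q : Kernel S S) [IsMarkovKernel Q]

lemma BddMeas.transfer_iterate (h : BddMeas g c) (n : ℕ) :
    BddMeas ((_root_.transfer Q)^[n] g) c := by
  induction n with
  | zero => exact h
  | succ n ih => rw [Function.iterate_succ_apply']; exact ih.transfer Q

lemma transfer_sub (h : BddMeas g c) (h' : BddMeas g' c') :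
    transfer Q (fun x => g x - g' x) = fun x => transfer Q g x - transfer Q g' x := by
  funext x; exact integral_sub (h.integrable _) (h'.integrable _)

lemma transfer_add (h : BddMeas g c) (h' : BddMeas g' c') :
    transfer Q (fun x => g x + g' x) = fun x => transfer Q g x + transfer Q g' x := by
  funext x; exact integral_add (h.integrable _) (h'.integrable _)

omit [IsMarkovKernel Q] in
lemma transfer_const_mul (a : ℝ) :
    transfer Q (fun x => a * g x) = fun x => a * transfer Q g x := by
  funext x; exact integral_const_mul _ _

lemma transfer_const (a : ℝ) : transfer Q (fun _ => a) = fun _ => a := by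
  funext x; simp [transfer]

lemma transfer_sum {ι : Type*} (s : Finset ι) {g : ι → S → ℝ} {c : ι → ℝ}
    (h : ∀ i, BddMeas (g i) (c i)) :
    transfer Q (fun x => ∑ i ∈ s, g i x) = fun x => ∑ i ∈ s, transfer Q (g i) x := by
  funext x; exact integral_finsetSum _ fun i _ => (h i).integrable _

lemma transfer_mono (h : BddMeas g c) (h' : BddMeas g' c') (hle : ∀ x, g x ≤ g' x) (x : S) :
    transfer Q g x ≤ transfer Q g' x :=
  integral_mono (h.integrable _) (h'.integrable _) hle

lemma transfer_iterate_sub (h : BddMeas g c) (h' : BddMeas g' c') (n : ℕ) :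
    (transfer Q)^[n] (fun x => g x - g' x) =
      fun x => (transfer Q)^[n] g x - (transfer Q)^[n] g' x := by
  induction n with
  | zero => rfl
  | succ n ih =>
    rw [Function.iterate_succ_apply', Function.iterate_succ_apply', Function.iterate_succ_apply',
      ih, transfer_sub Q (h.transfer_iterate Q n) (h'.transfer_iterate Q n)]

lemma transfer_iterate_add (h : BddMeas g c) (h' : BddMeas g' c') (n : ℕ) :
    (transfer Q)^[n] (fun x => g x + g' x) =
      fun x => (transfer Q)^[n] g x + (transfer Q)^[n] g' x := by
  induction n with
  | zero => rfl
  | succ n ih =>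
    rw [Function.iterate_succ_apply', Function.iterate_succ_apply', Function.iterate_succ_apply',
      ih, transfer_add Q (h.transfer_iterate Q n) (h'.transfer_iterate Q n)]

omit [IsMarkovKernel Q] in
lemma transfer_iterate_const_mul (a : ℝ) (n : ℕ) :
    (transfer Q)^[n] (fun x => a * g x) = fun x => a * (transfer Q)^[n] g x := by
  induction n with
  | zero => rfl
  | succ n ih =>
    rw [Function.iterate_succ_apply', Function.iterate_succ_apply', ih, transfer_const_mul Q]

lemma transfer_iterate_const (a : ℝ) (n : ℕ) :
    (transfer Q)^[n] (fun _ => a) = fun _ => a := by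
  induction n with
  | zero => rfl
  | succ n ih => rw [Function.iterate_succ_apply', ih, transfer_const]

omit [IsMarkovKernel Q] in
lemma abs_transfer_le (x : S) : |transfer Q g x| ≤ transfer Q (fun x => |g x|) x :=
  abs_integral_le_integral_abs

/-- Dominated convergence for iterates of a Markov kernel. -/
lemma tendsto_transfer_iterate_zero (m : ℕ) {g : ℕ → S → ℝ} (h : ∀ n, BddMeas (g n) c)
    (hlim : ∀ x, Tendsto (fun n => g n x) atTop (𝓝 0)) (x : S) :
    Tendsto (fun n => (transfer Q)^[m] (g n) x) atTop (𝓝 0) := by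
  induction m generalizing x with
  | zero => exact hlim x
  | succ m ih =>
    simp_rw [Function.iterate_succ_apply']
    have := tendsto_integral_of_dominated_convergence (μ := Q x) (fun _ => c)
      (fun n => ((h n).transfer_iterate Q m).meas.aestronglyMeasurable) (integrable_const c)
      (fun n => ae_of_all _ ((h n).transfer_iterate Q m).abs_le)
      (ae_of_all _ ih)
    rw [integral_zero] at this
    exact this

/-- Telescoping: each power of `Q` contracts the supremum norm, so every step costs at most `c`. -/
lemma abs_sub_transfer_iterate_le {w : S → ℝ} {c M : ℝ} (hw : BddMeas w M)
    (hc : ∀ y, |w y - transfer Q w y| ≤ c) (m : ℕ) (y : S) :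
    |w y - (transfer Q)^[m] w y| ≤ m * c := by
  induction m with
  | zero => simp
  | succ m ih =>
    have hd : BddMeas (fun y => w y - transfer Q w y) c :=
      ⟨hw.meas.sub (hw.transfer Q).meas, hc⟩
    have h1 := (hd.transfer_iterate Q m).abs_le y
    rw [transfer_iterate_sub Q hw (hw.transfer Q)] at h1
    rw [Function.iterate_succ_apply]
    calc _ = |(w y - (transfer Q)^[m] w y) +
            ((transfer Q)^[m] w y - (transfer Q)^[m] (transfer Q w) y)| := by
          congr 1; ring
      _ ≤ m * c + c := (abs_add_le _ _).trans (add_le_add ih h1)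
      _ = _ := by push_cast; ring

lemma integral_bind_kernel {S S' : Type*} [MeasurableSpace S] [MeasurableSpace S']
    (ν : Measure S) [IsFiniteMeasure ν] (K : Kernel S S') [IsMarkovKernel K] {g : S' → ℝ}
    {c : ℝ} (h : BddMeas g c) : ∫ y, g y ∂(ν.bind K) = ∫ x, transfer K g x ∂ν := by
  have := Kernel.integral_comp (κ := Kernel.const Unit ν) (η := K) (a := ()) (f := g)
    (h.integrable _)
  rwa [Kernel.comp_apply, Kernel.const_apply] at this

lemma integral_transfer_of_invariant {π : Measure S} [IsProbabilityMeasure π]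
    (hπ : Kernel.Invariant Q π) (h : BddMeas g c) : ∫ x, transfer Q g x ∂π = ∫ x, g x ∂π := by
  rw [← integral_bind_kernel π Q h, hπ.def]

lemma integral_transfer_iterate_of_invariant {π : Measure S} [IsProbabilityMeasure π]
    (hπ : Kernel.Invariant Q π) (h : BddMeas g c) (n : ℕ) :
    ∫ x, (transfer Q)^[n] g x ∂π = ∫ x, g x ∂π := by
  induction n with
  | zero => rfl
  | succ n ih =>
    simp_rw [Function.iterate_succ_apply']
    rw [integral_transfer_of_invariant Q hπ (h.transfer_iterate Q n), ih]

/-- The sum `g + Q g + ⋯ + Q ^ (n - 1) g`. -/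
noncomputable def potentialSum (Q : Kernel S S) (g : S → ℝ) (n : ℕ) (x : S) : ℝ :=
  ∑ k ∈ Finset.range n, (transfer Q)^[k] g x

lemma BddMeas.potentialSum (h : BddMeas g c) (n : ℕ) : BddMeas (potentialSum Q g n) (n * c) := by
  have := BddMeas.sum (Finset.range n) (fun k => h.transfer_iterate Q k)
  rwa [Finset.sum_const, Finset.card_range, nsmul_eq_mul] at this

lemma integral_potentialSum {π : Measure S} [IsProbabilityMeasure π]
    (hπ : Kernel.Invariant Q π) (h : BddMeas g c) (n : ℕ) :
    ∫ x, potentialSum Q g n x ∂π = n * ∫ x, g x ∂π := by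
  unfold potentialSum
  rw [integral_finsetSum _ fun k _ => (h.transfer_iterate Q k).integrable π]
  simp [integral_transfer_iterate_of_invariant Q hπ h]

/-- The sum telescopes. Thus `potentialSum Q g n` solves the Poisson equation up to an error that
stays bounded as `n` grows. -/
lemma potentialSum_sub_transfer (h : BddMeas g c) (n : ℕ) (x : S) :
    potentialSum Q g n x - transfer Q (potentialSum Q g n) x = g x - (transfer Q)^[n] g x := by
  have : transfer Q (potentialSum Q g n) x =
      ∑ k ∈ Finset.range n, (transfer Q)^[k + 1] g x := by
    unfold potentialSum
    rw [transfer_sum Q _ fun k => h.transfer_iterate Q k]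
    simp_rw [Function.iterate_succ_apply']
  rw [this, potentialSum, ← Finset.sum_sub_distrib, Finset.sum_range_sub']
  rfl

end Transfer

/-! ### Cesàro sums of a chain with a recurrent petite set -/

/-- The probability that the chain started from `x` avoids `V` at the times `0, …, n`. -/
noncomputable def avoidProb {S : Type*} [MeasurableSpace S] (Q : Kernel S S) (V : Set S) :
    ℕ → S → ℝ
  | 0 => Vᶜ.indicator fun _ => 1
  | n + 1 => Vᶜ.indicator (transfer Q (avoidProb Q V n))

section AvoidProb

variable {S : Type*} [MeasurableSpace S] (Q : Kernel S S) [IsMarkovKernel Q] {V : Set S}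

lemma avoidProb_bddMeas (hV : MeasurableSet V) (n : ℕ) : BddMeas (avoidProb Q V n) 1 := by
  induction n with
  | zero =>
    refine ⟨measurable_const.indicator hV.compl, fun x => ?_⟩
    by_cases hx : x ∈ V <;> simp [avoidProb, hx]
  | succ n ih =>
    refine ⟨(ih.transfer Q).meas.indicator hV.compl, fun x => ?_⟩
    by_cases hx : x ∈ V
    · simp [avoidProb, hx]
    · simpa [avoidProb, hx] using (ih.transfer Q).abs_le x

omit [IsMarkovKernel Q] in
lemma avoidProb_nonneg (n : ℕ) (x : S) : 0 ≤ avoidProb Q V n x := by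
  induction n generalizing x with
  | zero => exact Set.indicator_nonneg (fun _ _ => zero_le_one) x
  | succ n ih => exact Set.indicator_nonneg (fun x _ => integral_nonneg ih) x

omit [IsMarkovKernel Q] in
lemma avoidProb_of_mem (n : ℕ) {x : S} (hx : x ∈ V) : avoidProb Q V n x = 0 := by
  cases n <;> simp [avoidProb, hx]

omit [IsMarkovKernel Q] in
lemma avoidProb_succ_of_notMem (n : ℕ) {x : S} (hx : x ∉ V) :
    avoidProb Q V (n + 1) x = transfer Q (avoidProb Q V n) x := by
  simp [avoidProb, hx]

lemma avoidProb_antitone (hV : MeasurableSet V) (x : S) : Antitone fun n => avoidProb Q V n x := by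
  refine antitone_nat_of_succ_le fun n => ?_
  induction n generalizing x with
  | zero =>
    by_cases hx : x ∈ V
    · simp [avoidProb_of_mem, hx]
    · refine ((le_abs_self _).trans ((avoidProb_bddMeas Q hV 1).abs_le x)).trans ?_
      simp [avoidProb, hx]
  | succ n ih =>
    by_cases hx : x ∈ V
    · simp [avoidProb_of_mem, hx]
    · rw [avoidProb_succ_of_notMem Q _ hx, avoidProb_succ_of_notMem Q _ hx]
      exact transfer_mono Q (avoidProb_bddMeas Q hV _) (avoidProb_bddMeas Q hV _) ih x

end AvoidProb

/-- `V` is a recurrent set, with expected return times bounded by `C` on `V`, and the `m`-step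
transition probabilities from `V` dominate `p μ`. -/
structure IsPetiteRecurrent {S : Type*} [MeasurableSpace S] (Q : Kernel S S) (V : Set S)
    (μ : Measure S) (p C : ℝ) (m : ℕ) : Prop where
  measurableSet : MeasurableSet V
  pos : 0 < p
  nonneg : 0 ≤ C
  le_iterate : ∀ x ∈ V, ∀ (g : S → ℝ) (c : ℝ), BddMeas g c → (∀ y, 0 ≤ g y) →
    p * ∫ y, g y ∂μ ≤ (transfer Q)^[m] g x
  tendsto_avoidProb : ∀ x, Tendsto (fun n => avoidProb Q V n x) atTop (𝓝 0)
  sum_avoidProb_le : ∀ x ∈ V, ∀ n,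
    ∑ k ∈ Finset.range n, transfer Q (avoidProb Q V k) x ≤ C

/-! ### Functions with bounded defect `w - Q w`, entrance times and minorization -/

section PetiteRecurrent

variable {S : Type*} [MeasurableSpace S] {Q : Kernel S S} [IsMarkovKernel Q] {V : Set S}
  {μ : Measure S} [IsProbabilityMeasure μ] {p C : ℝ} {m : ℕ}

/-- The expectation of the entrance time of `V`, truncated at `n`. -/
noncomputable def entranceTime (Q : Kernel S S) (V : Set S) (n : ℕ) (x : S) : ℝ :=
  ∑ k ∈ Finset.range n, avoidProb Q V k x

variable (Q) in
lemma entranceTime_bddMeas (hV : MeasurableSet V) (n : ℕ) : BddMeas (entranceTime Q V n) n := by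
  have := BddMeas.sum (Finset.range n) (fun k => avoidProb_bddMeas Q hV k)
  rwa [Finset.sum_const, Finset.card_range, nsmul_eq_mul, mul_one] at this

variable (Q) in
lemma transfer_entranceTime (hV : MeasurableSet V) (n : ℕ) (x : S) :
    transfer Q (entranceTime Q V n) x = ∑ k ∈ Finset.range n, transfer Q (avoidProb Q V k) x := by
  unfold entranceTime
  rw [transfer_sum Q _ fun k => avoidProb_bddMeas Q hV k]

variable (Q) in
lemma entranceTime_succ_of_notMem (hV : MeasurableSet V) (n : ℕ) {x : S} (hx : x ∉ V) :
    entranceTime Q V (n + 1) x = 1 + transfer Q (entranceTime Q V n) x := by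
  rw [transfer_entranceTime Q hV, entranceTime, Finset.sum_range_succ', add_comm]
  simp [avoidProb, hx]

omit [IsMarkovKernel Q] in
lemma entranceTime_of_mem (n : ℕ) {x : S} (hx : x ∈ V) : entranceTime Q V n x = 0 := by
  simp [entranceTime, avoidProb_of_mem, hx]

/-- A function that changes little along the chain is controlled by its values on `V`. -/
lemma abs_le_entranceTime (hV : MeasurableSet V) {w : S → ℝ} {c D M : ℝ} (hw : BddMeas w M)
    (hc : ∀ y, |w y - transfer Q w y| ≤ c) (hD0 : 0 ≤ D) (hD : ∀ v ∈ V, |w v| ≤ D)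
    (n : ℕ) (y : S) :
    |w y| ≤ D + (c * entranceTime Q V n y + M * avoidProb Q V n y) := by
  induction n generalizing y with
  | zero =>
    by_cases hy : y ∈ V
    · simpa [entranceTime, avoidProb, hy] using hD y hy
    · simpa [entranceTime, avoidProb, hy] using (hw.abs_le y).trans (by linarith)
  | succ n ih =>
    by_cases hy : y ∈ V
    · simpa [entranceTime_of_mem, avoidProb_of_mem, hy] using hD y hy
    -- Off `V` one step gives `|w| ≤ c + Q |w|`; the extra `c` is the time unit by which the
    -- truncated entrance time grows.
    · have he := entranceTime_bddMeas Q hV n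
      have hq := avoidProb_bddMeas Q hV n
      have hb := ((BddMeas.const c).mul he).add ((BddMeas.const M).mul hq)
      have h1 := transfer_mono Q hw.abs ((BddMeas.const D).add hb) ih y
      rw [transfer_add Q (BddMeas.const D) hb, transfer_add Q ((BddMeas.const c).mul he)
        ((BddMeas.const M).mul hq), transfer_const, transfer_const_mul, transfer_const_mul] at h1
      rw [entranceTime_succ_of_notMem Q hV n hy, avoidProb_succ_of_notMem Q n hy]
      have h2 := abs_transfer_le Q (g := w) y
      have h3 : |w y| ≤ |w y - transfer Q w y| + |transfer Q w y| := by
        simpa using abs_add_le (w y - transfer Q w y) (transfer Q w y)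
      linarith [hc y]

namespace IsPetiteRecurrent

omit [IsProbabilityMeasure μ] in
-- Off `V` a step only shortens the entrance time; on `V` the expected return costs at most `C`.
lemma transfer_entranceTime_le (H : IsPetiteRecurrent Q V μ p C m) (n : ℕ) (x : S) :
    transfer Q (entranceTime Q V n) x ≤ C + entranceTime Q V (n + 1) x := by
  by_cases hx : x ∈ V
  · rw [transfer_entranceTime Q H.measurableSet, entranceTime_of_mem _ hx, add_zero]
    exact H.sum_avoidProb_le x hx n
  · linarith [entranceTime_succ_of_notMem Q H.measurableSet n hx, H.nonneg]

omit [IsProbabilityMeasure μ] in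
lemma iterate_entranceTime_le (H : IsPetiteRecurrent Q V μ p C m) (k n : ℕ) (x : S) :
    (transfer Q)^[k] (entranceTime Q V n) x ≤ k * C + entranceTime Q V (n + k) x := by
  induction k generalizing x with
  | zero => simp
  | succ k ih =>
    rw [Function.iterate_succ_apply']
    have he := entranceTime_bddMeas Q H.measurableSet
    have h1 := transfer_mono Q ((he n).transfer_iterate Q k)
      ((BddMeas.const (k * C)).add (he (n + k))) ih x
    rw [transfer_add Q (BddMeas.const (k * C)) (he (n + k)), transfer_const] at h1
    have h2 := H.transfer_entranceTime_le (n + k) x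
    push_cast
    rw [← add_assoc n k 1]
    linarith

/-- A function that changes little along the chain oscillates little on `V`. -/
lemma abs_le_of_mem (H : IsPetiteRecurrent Q V μ p C m) {w : S → ℝ} {c M : ℝ} (hw : BddMeas w M)
    (hc : ∀ y, |w y - transfer Q w y| ≤ c) (hμ : ∫ y, w y ∂μ = 0) {v : S} (hv : v ∈ V) :
    |w v| ≤ c * (m + m * C) / p := by
  have hc0 : 0 ≤ c := (abs_nonneg _).trans (hc v)
  have hM0 : 0 ≤ M := (abs_nonneg _).trans (hw.abs_le v)
  have hbdd : BddAbove (Set.range fun v : V => |w v|) :=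
    ⟨M, by rintro _ ⟨v, rfl⟩; exact hw.abs_le v⟩
  set D := ⨆ v : V, |w v| with hDdef
  have hD : ∀ v ∈ V, |w v| ≤ D := fun v hv => le_ciSup hbdd ⟨v, hv⟩
  have hD0 : 0 ≤ D := (abs_nonneg _).trans (hD v hv)
  -- A contraction: once the supremum `D` over `V` is known to be finite, this inequality can be
  -- solved for `D`.
  have key : ∀ u ∈ V, |w u| ≤ (1 - p) * D + c * (m + m * C) := by
    intro u hu
    have hlim : Tendsto (fun n => m * c + ((1 - p) * D + (c * (m * C) +
        M * (transfer Q)^[m] (avoidProb Q V n) u))) atTop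
        (𝓝 (m * c + ((1 - p) * D + (c * (m * C) + M * 0)))) :=
      ((((tendsto_transfer_iterate_zero Q m (avoidProb_bddMeas Q H.measurableSet)
        H.tendsto_avoidProb u).const_mul M).const_add _).const_add _).const_add _
    refine (ge_of_tendsto' hlim fun n => ?_).trans (le_of_eq (by ring))
    have he := (BddMeas.const c).mul (entranceTime_bddMeas Q H.measurableSet n)
    have hq := (BddMeas.const M).mul (avoidProb_bddMeas Q H.measurableSet n)
    have hr := he.add hq
    have hu' := (BddMeas.const D).add hr
    have hw' := abs_le_entranceTime H.measurableSet hw hc hD0 hD n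
    have hr0 : 0 ≤ ∫ y, (c * entranceTime Q V n y + M * avoidProb Q V n y) ∂μ :=
      integral_nonneg fun y => add_nonneg
        (mul_nonneg hc0 (Finset.sum_nonneg fun k _ => avoidProb_nonneg Q k y))
        (mul_nonneg hM0 (avoidProb_nonneg Q n y))
    have e1 : (transfer Q)^[m] (fun y => D + (c * entranceTime Q V n y + M * avoidProb Q V n y)) u
        ≤ D + (c * (m * C) + M * (transfer Q)^[m] (avoidProb Q V n) u) := by
      rw [transfer_iterate_add Q (BddMeas.const D) hr, transfer_iterate_add Q he hq,
        transfer_iterate_const, transfer_iterate_const_mul, transfer_iterate_const_mul]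
      have h1 := H.iterate_entranceTime_le m n u
      rw [entranceTime_of_mem _ hu, add_zero] at h1
      have := mul_le_mul_of_nonneg_left h1 hc0
      linarith
    have e2 : ∫ y, (D + (c * entranceTime Q V n y + M * avoidProb Q V n y)) ∂μ =
        D + ∫ y, (c * entranceTime Q V n y + M * avoidProb Q V n y) ∂μ := by
      rw [integral_add (integrable_const _) (hr.integrable μ)]; simp
    -- The majorant `U = D + c e + M q` of `|w|` makes `U - w` and `U + w` non-negative, so both may
    -- be minorized. As `w` has `μ`-mean zero, each minorant is `p ∫ U ∂μ ≥ p D`, which turns `D`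
    -- into `(1 - p) D`. The term with `M` disappears as `n → ∞`.
    have h1 := H.le_iterate u hu _ _ (hu'.sub hw)
      (fun y => sub_nonneg.2 ((le_abs_self _).trans (hw' y)))
    have h2 := H.le_iterate u hu _ _ (hu'.add hw)
      (fun y => by linarith [neg_abs_le (w y), hw' y])
    rw [transfer_iterate_sub Q hu' hw, integral_sub (hu'.integrable μ) (hw.integrable μ), hμ,
      e2] at h1
    rw [transfer_iterate_add Q hu' hw, integral_add (hu'.integrable μ) (hw.integrable μ), hμ,
      e2] at h2
    have hpr := mul_nonneg H.pos.le hr0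
    have h3 := abs_le.1 (abs_sub_transfer_iterate_le Q hw hc m u)
    rw [abs_le]
    constructor <;> linarith [h3.1, h3.2]
  have : Nonempty V := ⟨⟨v, hv⟩⟩
  have hDle : D ≤ (1 - p) * D + c * (m + m * C) := ciSup_le fun u => key u u.2
  refine (hD v hv).trans ?_
  rw [le_div_iff₀ H.pos]
  linarith

omit [IsProbabilityMeasure μ] in
lemma entranceTime_le (H : IsPetiteRecurrent Q V μ p C m) (N n : ℕ) (y : S) :
    entranceTime Q V n y ≤ N + n * avoidProb Q V N y := by
  have hq := avoidProb_bddMeas Q H.measurableSet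
  have hanti := avoidProb_antitone Q H.measurableSet y
  have h : ∀ k, avoidProb Q V k y ≤ (if k < N then 1 else 0) + avoidProb Q V N y := by
    intro k
    split_ifs with hk
    · linarith [(le_abs_self _).trans ((hq k).abs_le y), avoidProb_nonneg Q (V := V) N y]
    · simpa using hanti (not_lt.1 hk)
  refine (Finset.sum_le_sum fun k _ => h k).trans ?_
  rw [Finset.sum_add_distrib, Finset.sum_const, Finset.card_range, nsmul_eq_mul]
  gcongr
  rw [← Finset.sum_filter, Finset.sum_const, nsmul_eq_mul, mul_one]
  have : (Finset.range n).filter (· < N) ⊆ Finset.range N := fun k hk => by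
    simpa using (Finset.mem_filter.1 hk).2
  exact_mod_cast (Finset.card_le_card this).trans (by simp)

omit [IsProbabilityMeasure μ] in
lemma mul_avoidProb_le (H : IsPetiteRecurrent Q V μ p C m) (N n : ℕ) (y : S) :
    n * avoidProb Q V n y ≤ N + n * avoidProb Q V N y := by
  refine le_trans ?_ (H.entranceTime_le N n y)
  rw [entranceTime, ← nsmul_eq_mul, ← Finset.card_range n, ← Finset.sum_const,
    Finset.card_range n]
  exact Finset.sum_le_sum fun k hk =>
    avoidProb_antitone Q H.measurableSet y (Finset.mem_range.1 hk).le

/-- The sums of `Q ^ k g` for a centred `g` are sublinear, uniformly on `V`. -/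
lemma abs_potentialSum_le (H : IsPetiteRecurrent Q V μ p C m) {π : Measure S}
    [IsProbabilityMeasure π] (hπ : Kernel.Invariant Q π) {g : S → ℝ} {c : ℝ} (hg : BddMeas g c)
    (hg0 : ∫ x, g x ∂π = 0) {η : ℝ} (hη : 0 < η) :
    ∃ (N : ℕ) (B : ℝ), 0 ≤ B ∧ 4 * c * ∫ x, avoidProb Q V N x ∂π ≤ η ∧
      ∀ n y, |potentialSum Q g n y| ≤ B + η * n + 4 * c * n * avoidProb Q V N y := by
  obtain ⟨y0⟩ : Nonempty S := π.nonempty_of_neZero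
  have hc0 : 0 ≤ c := (abs_nonneg _).trans (hg.abs_le y0)
  have hq := avoidProb_bddMeas Q H.measurableSet
  have hlim : Tendsto (fun N => 4 * c * ∫ x, avoidProb Q V N x ∂π) atTop (𝓝 0) := by
    have := (tendsto_integral_of_dominated_convergence (μ := π) (fun _ => (1 : ℝ))
      (fun n => (hq n).meas.aestronglyMeasurable) (integrable_const 1)
      (fun n => ae_of_all _ (hq n).abs_le) (ae_of_all _ H.tendsto_avoidProb)).const_mul (4 * c)
    simpa using this
  obtain ⟨N, hN⟩ := (hlim.eventually (ge_mem_nhds hη)).exists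
  set A := 2 * c * (m + m * C) / p with hA
  have hA0 : 0 ≤ A := by have := H.nonneg; have := H.pos; positivity
  refine ⟨N, 2 * A + 8 * c * N, by positivity, hN, fun n y => ?_⟩
  set a := ∫ x, potentialSum Q g n x ∂μ with ha
  have hG := hg.potentialSum Q n
  -- Centring under `μ` prepares for `abs_le_of_mem`. The crude bound `2 * c * n` grows with `n`,
  -- but it is only ever multiplied by the probability of avoiding `V` up to time `n`.
  have hw : BddMeas (fun x => potentialSum Q g n x - a) (2 * c * n) :=
    (hG.sub (BddMeas.const a)).mono (by linarith [hG.abs_integral_le μ])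
  have hwT : ∀ y, |(potentialSum Q g n y - a) -
      transfer Q (fun x => potentialSum Q g n x - a) y| ≤ 2 * c := fun y => by
    rw [transfer_sub Q hG (BddMeas.const a), transfer_const]
    have := potentialSum_sub_transfer Q hg n y
    rw [sub_sub_sub_cancel_right, this]
    refine (abs_sub _ _).trans ?_
    linarith [hg.abs_le y, (hg.transfer_iterate Q n).abs_le y]
  have hwμ : ∫ y, (potentialSum Q g n y - a) ∂μ = 0 := by
    rw [integral_sub (hG.integrable μ) (integrable_const a)]; simp [ha]
  have hwb : ∀ y, |potentialSum Q g n y - a| ≤ A + 4 * c * N + 4 * c * n * avoidProb Q V N y := by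
    intro y
    have h1 := abs_le_entranceTime H.measurableSet hw hwT hA0
      (fun v hv => H.abs_le_of_mem hw hwT hwμ hv) n y
    have h2 := mul_le_mul_of_nonneg_left (H.entranceTime_le N n y) (by positivity : 0 ≤ 2 * c)
    have h3 := mul_le_mul_of_nonneg_left (H.mul_avoidProb_le N n y) (by positivity : 0 ≤ 2 * c)
    linarith
  -- By invariance the potential sum has `π`-mean `n ∫ g ∂π = 0`, so the `π`-mean of the centred
  -- function is `-a`.
  have hab : |a| ≤ A + 4 * c * N + η * n := by
    have h1 : ∫ y, (potentialSum Q g n y - a) ∂π = -a := by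
      rw [integral_sub (hG.integrable π) (integrable_const a), integral_potentialSum Q hπ hg, hg0]
      simp
    have hb := (BddMeas.const (A + 4 * c * N)).add
      ((BddMeas.const (4 * c * n)).mul (hq N))
    have h2 : |∫ y, (potentialSum Q g n y - a) ∂π| ≤
        ∫ y, (A + 4 * c * N + 4 * c * n * avoidProb Q V N y) ∂π :=
      abs_integral_le_integral_abs.trans (integral_mono (hw.abs.integrable π) (hb.integrable π) hwb)
    rw [h1, abs_neg, integral_add (integrable_const _)
      (((BddMeas.const (4 * c * n)).mul (hq N)).integrable π), integral_const_mul] at h2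
    have h3 := mul_le_mul_of_nonneg_right hN (Nat.cast_nonneg (α := ℝ) n)
    simp only [integral_const, probReal_univ, smul_eq_mul, one_mul] at h2
    linarith
  have h4 : |potentialSum Q g n y| ≤ |potentialSum Q g n y - a| + |a| := by
    simpa using abs_add_le (potentialSum Q g n y - a) a
  linarith [hwb y]

end IsPetiteRecurrent

end PetiteRecurrent

/-! ### Conditional laws and chains -/

/-- If `K (X ω)` is the conditional law of `ξ` given `m`, then `K b (X ω)` is the conditional
expectation of `b ξ`, for bounded `b`. -/
lemma integral_mul_eq_of_condLaw {Ω S S' : Type*} {m m0 : MeasurableSpace Ω} [MeasurableSpace S]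
    [MeasurableSpace S'] (hm : m ≤ m0) (P : Measure Ω) [IsProbabilityMeasure P] {X : Ω → S}
    {ξ : Ω → S'} (hX : Measurable[m] X) (hξ : Measurable ξ) (K : Kernel S S') [IsMarkovKernel K]
    (hlaw : ∀ A B, MeasurableSet[m] A → MeasurableSet B →
      P (A ∩ ξ ⁻¹' B) = ∫⁻ ω in A, K (X ω) B ∂P)
    {b : S' → ℝ} {c : ℝ} (hb : BddMeas b c) {H : Ω → ℝ} {C : ℝ} (hH : Measurable[m] H)
    (hHC : ∀ ω, |H ω| ≤ C) :
    ∫ ω, H ω * b (ξ ω) ∂P = ∫ ω, H ω * transfer K b (X ω) ∂P := by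
  have hX0 : Measurable X := hX.mono hm le_rfl
  have hbξ : BddMeas (fun ω => b (ξ ω)) c := hb.comp hξ
  have hg : BddMeas (fun ω => transfer K b (X ω)) c := (hb.transfer K).comp hX0
  have hset : ∀ A, MeasurableSet[m] A → P A < ∞ →
      ∫ ω in A, transfer K b (X ω) ∂P = ∫ ω in A, b (ξ ω) ∂P := by
    intro A hA _
    -- On each past event `A`, the law of `ξ` is the mixture of the laws `K (X ω)`; this identifies
    -- the conditional expectation.
    have hmap : (P.restrict A).map ξ = ((P.restrict A).map X).bind K := by
      ext B hB
      rw [Measure.map_apply hξ hB, Measure.restrict_apply (hξ hB), Set.inter_comm, hlaw A B hA hB,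
        Measure.bind_apply hB K.measurable.aemeasurable, lintegral_map (K.measurable_coe hB) hX0]
    rw [← integral_map hξ.aemeasurable hb.meas.aestronglyMeasurable, hmap,
      integral_bind_kernel _ K hb,
      integral_map hX0.aemeasurable (hb.transfer K).meas.aestronglyMeasurable]
  have hcond : (fun ω => transfer K b (X ω)) =ᵐ[P] P[(fun ω => b (ξ ω)) | m] :=
    ae_eq_condExp_of_forall_setIntegral_eq hm (hbξ.integrable P)
      (fun s _ _ => (hg.integrable P).integrableOn) hset
      (((hb.transfer K).meas.comp hX).stronglyMeasurable.aestronglyMeasurable)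
  have hpull := condExp_stronglyMeasurable_mul_of_bound hm hH.stronglyMeasurable
    (hbξ.integrable P) C (ae_of_all P hHC)
  have h1 : ∫ ω, H ω * b (ξ ω) ∂P = ∫ ω, (P[H * (fun ω => b (ξ ω)) | m]) ω ∂P :=
    (integral_condExp hm).symm
  rw [h1, integral_congr_ae hpull]
  refine integral_congr_ae ?_
  filter_upwards [hcond] with ω hω
  simp [hω]

/-- `X` is a Markov chain with kernel `Q`, with respect to `ℱ`, started from `x`. -/
structure IsChainFrom {S Ω : Type*} [MeasurableSpace S] [m0 : MeasurableSpace Ω] (Q : Kernel S S)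
    (P : Measure Ω) (ℱ : ℕ → MeasurableSpace Ω) (X : ℕ → Ω → S) (x : S) : Prop where
  le : ∀ t, ℱ t ≤ m0
  mono : Monotone ℱ
  adapted : ∀ t, Measurable[ℱ t] (X t)
  start : P.map (X 0) = Measure.dirac x
  markov : ∀ t A B, MeasurableSet[ℱ t] A → MeasurableSet B →
    P (A ∩ X (t + 1) ⁻¹' B) = ∫⁻ ω in A, Q (X t ω) B ∂P

namespace IsChainFrom

variable {S Ω : Type*} [MeasurableSpace S] [MeasurableSpace Ω] {Q : Kernel S S} [IsMarkovKernel Q]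
  {P : Measure Ω} {ℱ : ℕ → MeasurableSpace Ω} {X : ℕ → Ω → S} {x : S}
  {g : S → ℝ} {H : Ω → ℝ} {c C : ℝ}

omit [IsMarkovKernel Q] in
lemma measurable (hX : IsChainFrom Q P ℱ X x) (t : ℕ) : Measurable (X t) :=
  (hX.adapted t).mono (hX.le t) le_rfl

omit [IsMarkovKernel Q] in
lemma integral_start (hX : IsChainFrom Q P ℱ X x) (hg : BddMeas g c) :
    ∫ ω, g (X 0 ω) ∂P = g x := by
  rw [← integral_map (hX.measurable 0).aemeasurable hg.meas.aestronglyMeasurable, hX.start,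
    integral_dirac' _ _ hg.meas.stronglyMeasurable]

variable [IsProbabilityMeasure P]

/-- The Markov property applied `k` times. The weight `H`, known at time `s`, allows for
correlations and for indicators of the past. -/
lemma integral_mul_iterate (hX : IsChainFrom Q P ℱ X x) (hg : BddMeas g c) {s : ℕ}
    (hH : Measurable[ℱ s] H) (hHC : ∀ ω, |H ω| ≤ C) (k : ℕ) :
    ∫ ω, H ω * g (X (s + k) ω) ∂P = ∫ ω, H ω * (transfer Q)^[k] g (X s ω) ∂P := by
  induction k generalizing g with
  | zero => rfl
  | succ k ih =>
    rw [Function.iterate_succ_apply, ← ih (hg.transfer Q)]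
    exact integral_mul_eq_of_condLaw (hX.le _) P (hX.adapted _) (hX.measurable _) Q
      (hX.markov (s + k)) hg (hH.mono (hX.mono (Nat.le_add_right s k)) le_rfl) hHC

lemma integral_comp (hX : IsChainFrom Q P ℱ X x) (hg : BddMeas g c) (k : ℕ) :
    ∫ ω, g (X k ω) ∂P = (transfer Q)^[k] g x := by
  have := hX.integral_mul_iterate hg (s := 0) (H := fun _ => 1) (C := 1)
    measurable_const (by simp) k
  simp only [one_mul, zero_add] at this
  rw [this, hX.integral_start (hg.transfer_iterate Q k)]

/-- The indicator of the event that `V` is avoided at the times `1, …, j`. -/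
noncomputable def avoidInd (X : ℕ → Ω → S) (V : Set S) (j : ℕ) (ω : Ω) : ℝ :=
  ∏ i ∈ Finset.range j, Vᶜ.indicator (fun _ => 1) (X (i + 1) ω)

omit [MeasurableSpace S] [MeasurableSpace Ω] in
lemma avoidInd_nonneg (X : ℕ → Ω → S) (V : Set S) (j : ℕ) (ω : Ω) : 0 ≤ avoidInd X V j ω :=
  Finset.prod_nonneg fun _ _ => Set.indicator_nonneg (fun _ _ => zero_le_one) _

omit [MeasurableSpace S] [MeasurableSpace Ω] in
lemma avoidInd_le_one (X : ℕ → Ω → S) (V : Set S) (j : ℕ) (ω : Ω) : avoidInd X V j ω ≤ 1 :=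
  Finset.prod_le_one (fun _ _ => Set.indicator_nonneg (fun _ _ => zero_le_one) _)
    fun _ _ => Set.indicator_apply_le' (fun _ => le_rfl) (fun _ => zero_le_one)

omit [MeasurableSpace S] [MeasurableSpace Ω] in
lemma abs_avoidInd_le (X : ℕ → Ω → S) (V : Set S) (j : ℕ) (ω : Ω) : |avoidInd X V j ω| ≤ 1 := by
  rw [abs_of_nonneg (avoidInd_nonneg X V j ω)]; exact avoidInd_le_one X V j ω

omit [MeasurableSpace S] [MeasurableSpace Ω] in
lemma avoidInd_eq_zero {V : Set S} {i j : ℕ} {ω : Ω} (hi : 1 ≤ i) (hij : i ≤ j)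
    (hV : X i ω ∈ V) : avoidInd X V j ω = 0 := by
  refine Finset.prod_eq_zero (i := i - 1) (Finset.mem_range.2 (by omega)) ?_
  simp [Nat.sub_add_cancel hi, hV]

omit [IsMarkovKernel Q] [IsProbabilityMeasure P] in
lemma measurable_avoidInd (hX : IsChainFrom Q P ℱ X x) {V : Set S} (hV : MeasurableSet V) (j : ℕ) :
    Measurable[ℱ j] (avoidInd X V j) := by
  unfold avoidInd
  refine Finset.measurable_fun_prod _ fun i hi => ?_
  have h1 : Measurable (Vᶜ.indicator (fun _ => (1 : ℝ))) := measurable_const.indicator hV.compl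
  exact h1.comp ((hX.adapted (i + 1)).mono (hX.mono (Finset.mem_range.1 hi)) le_rfl)

/-- Conditioning on time `j + 1` replaces `avoidProb` at the next time by its transfer; multiplied
by the last indicator factor, this is `avoidProb` of one higher index. The factors are absorbed one
at a time. -/
lemma integral_avoidInd_mul (hX : IsChainFrom Q P ℱ X x) {V : Set S} (hV : MeasurableSet V)
    (j n : ℕ) : ∫ ω, avoidInd X V j ω * avoidProb Q V n (X (j + 1) ω) ∂P =
      transfer Q (avoidProb Q V (n + j)) x := by
  induction j generalizing n with
  | zero => simpa [avoidInd] using hX.integral_comp (avoidProb_bddMeas Q hV n) 1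
  | succ j ih =>
    rw [hX.integral_mul_iterate (avoidProb_bddMeas Q hV n) (hX.measurable_avoidInd hV (j + 1))
      (abs_avoidInd_le X V _) 1, show n + (j + 1) = n + 1 + j by omega, ← ih]
    congr 1
    funext ω
    rw [avoidInd, Finset.prod_range_succ, ← avoidInd, mul_assoc]
    congr 1
    by_cases h : X (j + 1) ω ∈ V <;> simp [h, avoidProb]

lemma integral_avoidInd (hX : IsChainFrom Q P ℱ X x) {V : Set S} (hV : MeasurableSet V) (n : ℕ) :
    ∫ ω, avoidInd X V (n + 1) ω ∂P = transfer Q (avoidProb Q V n) x := by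
  have := hX.integral_avoidInd_mul hV n 0
  rw [zero_add] at this
  rw [← this]
  congr 1
  funext ω
  rw [avoidInd, Finset.prod_range_succ, ← avoidInd, avoidProb]

lemma tendsto_avoidProb (hX : IsChainFrom Q P ℱ X x) {V : Set S} (hV : MeasurableSet V)
    (hrec : ∀ᵐ ω ∂P, returnTime X V ω < ⊤) :
    Tendsto (fun n => avoidProb Q V n x) atTop (𝓝 0) := by
  have hlim : Tendsto (fun n => ∫ ω, avoidInd X V (n + 1) ω ∂P) atTop (𝓝 (∫ _, 0 ∂P)) := by
    refine tendsto_integral_of_dominated_convergence (fun _ => (1 : ℝ))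
      (fun n => ((hX.measurable_avoidInd hV (n + 1)).mono (hX.le _) le_rfl).aestronglyMeasurable)
      (integrable_const 1) (fun n => ae_of_all _ (abs_avoidInd_le X V _)) ?_
    filter_upwards [hrec] with ω hω
    obtain ⟨i, hi⟩ := iInf_lt_iff.1 hω
    obtain ⟨⟨h1, h2⟩, -⟩ := iInf_lt_iff.1 hi
    refine tendsto_const_nhds.congr' ?_
    filter_upwards [eventually_ge_atTop i] with n hn
    exact (avoidInd_eq_zero h1 (hn.trans n.le_succ) h2).symm
  simp_rw [hX.integral_avoidInd hV, integral_zero] at hlim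
  -- Return times start at `1` and entrance times at `0`: off `V` the two avoidance probabilities
  -- agree after this shift, and on `V` the entrance version is zero.
  rw [← tendsto_add_atTop_iff_nat 1]
  refine squeeze_zero (fun n => avoidProb_nonneg Q _ x) (fun n => ?_) hlim
  by_cases hx : x ∈ V
  · rw [avoidProb_of_mem Q _ hx]; exact integral_nonneg (avoidProb_nonneg Q n)
  · rw [avoidProb_succ_of_notMem Q _ hx]

omit [MeasurableSpace S] [MeasurableSpace Ω] in
lemma sum_avoidInd_le (V : Set S) (n : ℕ) (ω : Ω) :
    ENNReal.ofReal (∑ k ∈ Finset.range n, avoidInd X V (k + 1) ω) ≤ returnTime X V ω := by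
  have key : ∀ i : ℕ, 1 ≤ i → X i ω ∈ V →
      ENNReal.ofReal (∑ k ∈ Finset.range n, avoidInd X V (k + 1) ω) ≤ i := by
    intro i h1 h2
    have h : ∑ k ∈ Finset.range n, avoidInd X V (k + 1) ω ≤ i := by
      calc _ ≤ ∑ k ∈ Finset.range n, (if k < i then (1 : ℝ) else 0) := by
            refine Finset.sum_le_sum fun k _ => ?_
            split_ifs with hk
            · exact avoidInd_le_one X V _ ω
            · exact (avoidInd_eq_zero h1 (by omega) h2).le
        _ ≤ i := by
            rw [← Finset.sum_filter, Finset.sum_const, nsmul_eq_mul, mul_one]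
            have : (Finset.range n).filter (· < i) ⊆ Finset.range i := fun k hk => by
              simpa using (Finset.mem_filter.1 hk).2
            exact_mod_cast (Finset.card_le_card this).trans (by simp)
    simpa using ENNReal.ofReal_le_ofReal h
  rcases eq_or_ne (returnTime X V ω) ⊤ with htop | hne
  · simp [htop]
  · have : ∃ i : ℕ, (1 ≤ i ∧ X i ω ∈ V) ∧ (i : ℕ∞) < returnTime X V ω + 1 := by
      have hlt : returnTime X V ω < returnTime X V ω + 1 := by
        lift returnTime X V ω to ℕ using hne with a
        exact_mod_cast Nat.lt_succ_self a
      obtain ⟨i, hi⟩ := iInf_lt_iff.1 hlt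
      obtain ⟨h, hi⟩ := iInf_lt_iff.1 hi
      exact ⟨i, h, hi⟩
    obtain ⟨i, h, hi⟩ := this
    refine (key i h.1 h.2).trans ?_
    have : (i : ℕ∞) ≤ returnTime X V ω := Order.le_of_lt_add_one hi
    exact_mod_cast ENat.toENNReal_mono this

/-- The `k`-th summand is the probability that the return time exceeds `k + 1`, so the sum is at
most its expectation. -/
lemma sum_avoidProb_le (hX : IsChainFrom Q P ℱ X x) {V : Set S} (hV : MeasurableSet V) (n : ℕ) :
    ENNReal.ofReal (∑ k ∈ Finset.range n, transfer Q (avoidProb Q V k) x) ≤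
      ∫⁻ ω, (returnTime X V ω : ℝ≥0∞) ∂P := by
  have hb : ∀ j, BddMeas (avoidInd X V j) 1 := fun j =>
    ⟨(hX.measurable_avoidInd hV j).mono (hX.le _) le_rfl, abs_avoidInd_le X V j⟩
  simp_rw [← hX.integral_avoidInd hV]
  rw [← integral_finsetSum _ fun k _ => (hb (k + 1)).integrable P,
    ofReal_integral_eq_lintegral_ofReal (integrable_finsetSum _ fun k _ => (hb _).integrable P)
      (ae_of_all _ fun ω => Finset.sum_nonneg fun k _ => avoidInd_nonneg X V _ ω)]
  exact lintegral_mono fun ω => sum_avoidInd_le V n ω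

end IsChainFrom

/-- The off-diagonal terms of the square are counted exactly and the diagonal twice. Ordering by the
lag `k` makes the conditional expectation of the inner sum a potential sum of length `t - u`. -/
lemma sq_sum_range_le (a : ℕ → ℝ) (t : ℕ) : (∑ u ∈ Finset.range t, a u) ^ 2 ≤
    2 * ∑ u ∈ Finset.range t, ∑ k ∈ Finset.range (t - u), a u * a (u + k) := by
  induction t with
  | zero => simp
  | succ t ih =>
    have h : ∑ u ∈ Finset.range t, ∑ k ∈ Finset.range (t + 1 - u), a u * a (u + k) =
        ∑ u ∈ Finset.range t, ∑ k ∈ Finset.range (t - u), a u * a (u + k) +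
          (∑ u ∈ Finset.range t, a u) * a t := by
      rw [Finset.sum_mul, ← Finset.sum_add_distrib]
      refine Finset.sum_congr rfl fun u hu => ?_
      have hu := Finset.mem_range.1 hu
      rw [show t + 1 - u = (t - u) + 1 by omega, Finset.sum_range_succ,
        show u + (t - u) = t by omega]
    rw [Finset.sum_range_succ, Finset.sum_range_succ, h]
    simp only [add_tsub_cancel_left, Finset.range_one, Finset.sum_singleton, add_zero]
    nlinarith [sq_nonneg (a t)]

/-- The law of large numbers in `L²` for a centred function of the chain, uniformly over the
starting points in `V`. -/
lemma IsPetiteRecurrent.integral_sq_sum_le {S Ω : Type*} [MeasurableSpace S] [MeasurableSpace Ω]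
    {Q : Kernel S S} [IsMarkovKernel Q] {V : Set S} {μ : Measure S} [IsProbabilityMeasure μ]
    {p C : ℝ} {m : ℕ} (H : IsPetiteRecurrent Q V μ p C m) {π : Measure S}
    [IsProbabilityMeasure π] (hπ : Kernel.Invariant Q π) {g : S → ℝ} {c : ℝ} (hg : BddMeas g c)
    (hg0 : ∫ x, g x ∂π = 0) {ε : ℝ} (hε : 0 < ε) :
    ∃ B : ℝ, 0 ≤ B ∧ ∀ (P : Measure Ω) [IsProbabilityMeasure P] (ℱ : ℕ → MeasurableSpace Ω)
      (X : ℕ → Ω → S) (x : S), x ∈ V → IsChainFrom Q P ℱ X x →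
      ∀ t : ℕ, ∫ ω, (∑ u ∈ Finset.range t, g (X u ω)) ^ 2 ∂P ≤ B + ε * t ^ 2 := by
  obtain ⟨y0⟩ : Nonempty S := π.nonempty_of_neZero
  have hc0 : 0 ≤ c := (abs_nonneg _).trans (hg.abs_le y0)
  -- The final bound contains `η * t ^ 2` four times with the factor `2 * c`. The `+ 1` in the
  -- denominators allows `c = 0`.
  obtain ⟨η, hη, hηε⟩ : ∃ η > 0, 8 * c * η ≤ ε := by
    refine ⟨ε / (8 * c + 1), by positivity, ?_⟩
    rw [← mul_div_assoc, div_le_iff₀ (by positivity)]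
    nlinarith
  obtain ⟨η', hη', hηη⟩ : ∃ η' > 0, 4 * c * η' ≤ η := by
    refine ⟨η / (4 * c + 1), by positivity, ?_⟩
    rw [← mul_div_assoc, div_le_iff₀ (by positivity)]
    nlinarith
  obtain ⟨N, B, hB, hN, hG⟩ := H.abs_potentialSum_le hπ hg hg0 hη
  have hq := avoidProb_bddMeas Q H.measurableSet N
  set q := ∫ x, avoidProb Q V N x ∂π with hqdef
  have hq' := hq.sub (BddMeas.const q)
  -- Second use of the estimate, for the centred avoidance probability. Starting points in `V` make
  -- its own error term vanish.
  obtain ⟨N', B', hB', -, hG'⟩ := H.abs_potentialSum_le hπ hq'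
    (by rw [integral_sub (hq.integrable π) (integrable_const _)]; simp [hqdef]) hη'
  have hpot : ∀ x ∈ V, ∀ t, potentialSum Q (avoidProb Q V N) t x ≤ B' + (q + η') * t := by
    intro x hx t
    have h1 := (le_abs_self _).trans (hG' t x)
    rw [avoidProb_of_mem Q _ hx] at h1
    have h2 : potentialSum Q (fun x => avoidProb Q V N x - q) t x =
        potentialSum Q (avoidProb Q V N) t x - t * q := by
      unfold potentialSum
      simp_rw [transfer_iterate_sub Q hq (BddMeas.const q), transfer_iterate_const]
      simp
    rw [h2] at h1
    linarith
  set β := B + 4 * c * B' with hβ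
  refine ⟨2 * c * (β ^ 2 / η), by positivity, fun P _ ℱ X x hx hX t => ?_⟩
  have hgX : ∀ u, BddMeas (fun ω => g (X u ω)) c := fun u => hg.comp (hX.measurable u)
  have step : ∀ u ∈ Finset.range t,
      ∑ k ∈ Finset.range (t - u), ∫ ω, g (X u ω) * g (X (u + k) ω) ∂P ≤
        c * (B + η * t + 4 * c * t * (transfer Q)^[u] (avoidProb Q V N) x) := by
    intro u _
    have e1 : ∑ k ∈ Finset.range (t - u), ∫ ω, g (X u ω) * g (X (u + k) ω) ∂P =
        ∫ ω, g (X u ω) * potentialSum Q g (t - u) (X u ω) ∂P := by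
      unfold potentialSum
      simp_rw [Finset.mul_sum]
      rw [integral_finsetSum _ fun k _ =>
        ((hgX u).mul ((hg.transfer_iterate Q k).comp (hX.measurable u))).integrable P]
      exact Finset.sum_congr rfl fun k _ =>
        hX.integral_mul_iterate hg (hg.meas.comp (hX.adapted u)) (fun ω => hg.abs_le _) k
    have hqu := hq.comp (hX.measurable u)
    have hb := (BddMeas.const c).mul ((BddMeas.const (B + η * t)).add
      ((BddMeas.const (4 * c * t)).mul hqu))
    have e2 : ∫ ω, g (X u ω) * potentialSum Q g (t - u) (X u ω) ∂P ≤
        ∫ ω, c * ((B + η * t) + 4 * c * t * avoidProb Q V N (X u ω)) ∂P := by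
      refine integral_mono
        (((hgX u).mul ((hg.potentialSum Q (t - u)).comp (hX.measurable u))).integrable P)
        (hb.integrable P) fun ω => ?_
      refine (le_abs_self _).trans ?_
      rw [abs_mul]
      refine mul_le_mul (hg.abs_le _) ((hG _ _).trans ?_) (abs_nonneg _) hc0
      have hle : ((t - u : ℕ) : ℝ) ≤ t := by exact_mod_cast Nat.sub_le t u
      have := avoidProb_nonneg Q (V := V) N (X u ω)
      gcongr
    rw [e1]
    refine e2.trans (le_of_eq ?_)
    rw [integral_const_mul, integral_add (integrable_const _)
      (((BddMeas.const (4 * c * t)).mul hqu).integrable P), integral_const_mul, hX.integral_comp hq]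
    simp
  have hint : ∀ u k, Integrable (fun ω => g (X u ω) * g (X (u + k) ω)) P := fun u k =>
    ((hgX u).mul (hgX (u + k))).integrable P
  have hsq : Integrable (fun ω => (∑ u ∈ Finset.range t, g (X u ω)) ^ 2) P := by
    simp_rw [sq]
    exact ((BddMeas.sum _ hgX).mul (BddMeas.sum _ hgX)).integrable P
  calc ∫ ω, (∑ u ∈ Finset.range t, g (X u ω)) ^ 2 ∂P
      ≤ ∫ ω, 2 * ∑ u ∈ Finset.range t, ∑ k ∈ Finset.range (t - u),
          g (X u ω) * g (X (u + k) ω) ∂P :=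
        integral_mono hsq ((integrable_finsetSum _ fun u _ => integrable_finsetSum _ fun k _ =>
          hint u k).const_mul 2) fun ω => sq_sum_range_le (fun u => g (X u ω)) t
    _ = 2 * ∑ u ∈ Finset.range t, ∑ k ∈ Finset.range (t - u),
          ∫ ω, g (X u ω) * g (X (u + k) ω) ∂P := by
        rw [integral_const_mul, integral_finsetSum _ fun u _ => integrable_finsetSum _ fun k _ =>
          hint u k]
        congr 1
        exact Finset.sum_congr rfl fun u _ => integral_finsetSum _ fun k _ => hint u k
    _ ≤ 2 * ∑ u ∈ Finset.range t,
          c * (B + η * t + 4 * c * t * (transfer Q)^[u] (avoidProb Q V N) x) := by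
        gcongr with u hu; exact step u hu
    _ = 2 * c * (B * t + η * t ^ 2 + 4 * c * t * potentialSum Q (avoidProb Q V N) t x) := by
        rw [← Finset.mul_sum, Finset.sum_add_distrib, ← Finset.mul_sum, potentialSum]
        simp only [Finset.sum_const, Finset.card_range, nsmul_eq_mul]
        ring
    _ ≤ 2 * c * (B * t + η * t ^ 2 + 4 * c * t * (B' + (q + η') * t)) := by
        gcongr; exact hpot x hx t
    _ = 2 * c * (β * t + η * t ^ 2 + (4 * c * q) * t ^ 2 + (4 * c * η') * t ^ 2) := by
        rw [hβ]; ring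
    _ ≤ 2 * c * ((β ^ 2 / η + η * t ^ 2) + η * t ^ 2 + η * t ^ 2 + η * t ^ 2) := by
        gcongr
        -- Young's inequality `β t ≤ β ^ 2 / η + η t ^ 2`; the last two terms use `4 c q ≤ η` and `4
        -- c η' ≤ η`.
        rw [div_add' _ _ _ hη.ne', le_div_iff₀ hη]
        nlinarith [sq_nonneg (β - η * t), sq_nonneg (β + η * t), sq_nonneg β, sq_nonneg (η * t)]
    _ = 2 * c * (β ^ 2 / η) + (8 * c * η) * t ^ 2 := by ring
    _ ≤ _ := by gcongr

/-! ### Additive functionals of sampled variables -/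

/-- Given the past `𝒢 t`, the variable `ξ t` has the distribution `K (X t)`. -/
structure IsSampledFrom {S Ω : Type*} [MeasurableSpace S] [m0 : MeasurableSpace Ω]
    (K : Kernel S ℝ) (P : Measure Ω) (𝒢 : ℕ → MeasurableSpace Ω) (X : ℕ → Ω → S)
    (ξ : ℕ → Ω → ℝ) : Prop where
  le : ∀ t, 𝒢 t ≤ m0
  mono : Monotone 𝒢
  adapted : ∀ t, Measurable[𝒢 t] (X t)
  measurable_succ : ∀ t, Measurable[𝒢 (t + 1)] (ξ t)
  law : ∀ t A B, MeasurableSet[𝒢 t] A → MeasurableSet B →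
    P (A ∩ ξ t ⁻¹' B) = ∫⁻ ω in A, K (X t ω) B ∂P

section Sampled

variable {S Ω : Type*} [MeasurableSpace S] [MeasurableSpace Ω] {K : Kernel S ℝ} [IsMarkovKernel K]
  {P : Measure Ω} {𝒢 : ℕ → MeasurableSpace Ω} {X : ℕ → Ω → S}
  {ξ : ℕ → Ω → ℝ} {b : ℝ → ℝ} {c : ℝ}

namespace IsSampledFrom

omit [IsMarkovKernel K] in
lemma measurable (h : IsSampledFrom K P 𝒢 X ξ) (t : ℕ) : Measurable (ξ t) :=
  (h.measurable_succ t).mono (h.le _) le_rfl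

omit [IsMarkovKernel K] in
lemma measurable_left (h : IsSampledFrom K P 𝒢 X ξ) (t : ℕ) : Measurable (X t) :=
  (h.adapted t).mono (h.le _) le_rfl

omit [IsMarkovKernel K] in
lemma lintegral_comp (h : IsSampledFrom K P 𝒢 X ξ) {f : ℝ → ℝ≥0∞} (hf : Measurable f) (t : ℕ) :
    ∫⁻ ω, f (ξ t ω) ∂P = ∫⁻ ω, ∫⁻ r, f r ∂(K (X t ω)) ∂P := by
  have hmap : P.map (ξ t) = (P.map (X t)).bind K := by
    ext B hB
    have := h.law t Set.univ B MeasurableSet.univ hB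
    rw [Set.univ_inter, Measure.restrict_univ] at this
    rw [Measure.map_apply (h.measurable t) hB, this, Measure.bind_apply hB
      K.measurable.aemeasurable, lintegral_map (K.measurable_coe hB) (h.measurable_left t)]
  rw [← lintegral_map hf (h.measurable t), hmap,
    Measure.lintegral_bind K.measurable.aemeasurable hf.aemeasurable,
    lintegral_map hf.lintegral_kernel (h.measurable_left t)]

variable [IsProbabilityMeasure P]

/-- Orthogonality of martingale differences. -/
lemma integral_sq_sum_le (h : IsSampledFrom K P 𝒢 X ξ) (hb : BddMeas b c) (t : ℕ) :
    ∫ ω, (∑ u ∈ Finset.range t, (b (ξ u ω) - transfer K b (X u ω))) ^ 2 ∂P ≤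
      (2 * c) ^ 2 * t := by
  have hd : ∀ u, BddMeas (fun ω => b (ξ u ω) - transfer K b (X u ω)) (c + c) := fun u =>
    (hb.comp (h.measurable u)).sub ((hb.transfer K).comp (h.measurable_left u))
  induction t with
  | zero => simp
  | succ t ih =>
    set D : Ω → ℝ := fun ω => ∑ u ∈ Finset.range t, (b (ξ u ω) - transfer K b (X u ω)) with hD
    have hDb : BddMeas D (∑ _u ∈ Finset.range t, (c + c)) := BddMeas.sum _ hd
    have hDm : Measurable[𝒢 t] D := by
      refine Finset.measurable_fun_sum _ fun u hu => ?_
      have hu := Finset.mem_range.1 hu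
      exact (hb.meas.comp ((h.measurable_succ u).mono (h.mono hu) le_rfl)).sub
        ((hb.transfer K).meas.comp ((h.adapted u).mono (h.mono hu.le) le_rfl))
    -- The earlier sum `D` belongs to the past `𝒢 t`, given which the new difference has mean zero.
    have horth : ∫ ω, D ω * (b (ξ t ω) - transfer K b (X t ω)) ∂P = 0 := by
      simp_rw [mul_sub]
      rw [integral_sub ((hDb.mul (hb.comp (h.measurable t))).integrable P)
        ((hDb.mul ((hb.transfer K).comp (h.measurable_left t))).integrable P), sub_eq_zero]
      exact integral_mul_eq_of_condLaw (h.le t) P (h.adapted t) (h.measurable t) K (h.law t) hb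
        hDm hDb.abs_le
    have hsplit : ∀ ω, (∑ u ∈ Finset.range (t + 1), (b (ξ u ω) - transfer K b (X u ω))) ^ 2 =
        D ω * D ω + 2 * (D ω * (b (ξ t ω) - transfer K b (X t ω))) +
        (b (ξ t ω) - transfer K b (X t ω)) * (b (ξ t ω) - transfer K b (X t ω)) := fun ω => by
      rw [Finset.sum_range_succ]; ring
    have hi1 := (hDb.mul hDb).integrable P
    have hi2 := ((hDb.mul (hd t)).integrable P).const_mul 2
    have hdd := (hd t).mul (hd t)
    simp_rw [hsplit]
    rw [integral_add (hi1.fun_add hi2) (hdd.integrable P), integral_add hi1 hi2, integral_const_mul,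
      horth]
    have ih' : ∫ ω, D ω * D ω ∂P ≤ (2 * c) ^ 2 * t := by
      simp_rw [← sq]; exact ih
    have := (le_abs_self _).trans (hdd.abs_integral_le P)
    push_cast
    linarith

end IsSampledFrom

/-- The law of large numbers in `L¹` for bounded functions of the sampled variables, uniformly
over the starting points in `V`. -/
lemma IsPetiteRecurrent.integral_abs_sum_le {Q : Kernel S S} [IsMarkovKernel Q] {V : Set S}
    {μ : Measure S} [IsProbabilityMeasure μ]
    {p C : ℝ} {m : ℕ} (H : IsPetiteRecurrent Q V μ p C m) {π : Measure S}
    [IsProbabilityMeasure π] (hπ : Kernel.Invariant Q π) (hb : BddMeas b c) {ε : ℝ} (hε : 0 < ε) :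
    ∃ B : ℝ, 0 ≤ B ∧ ∀ (P : Measure Ω) [IsProbabilityMeasure P] (ℱ 𝒢 : ℕ → MeasurableSpace Ω)
      (X : ℕ → Ω → S) (ξ : ℕ → Ω → ℝ) (x : S), x ∈ V → IsChainFrom Q P ℱ X x →
      IsSampledFrom K P 𝒢 X ξ → ∀ t : ℕ,
      ∫ ω, |∑ u ∈ Finset.range t, (b (ξ u ω) - ∫ x, transfer K b x ∂π)| ∂P ≤ B + ε * t := by
  set a := ∫ x, transfer K b x ∂π with ha
  have hKb := hb.transfer K
  have hg : BddMeas (fun x => transfer K b x - a) (c + |a|) := hKb.sub (BddMeas.const a)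
  have hg0 : ∫ x, (transfer K b x - a) ∂π = 0 := by
    rw [integral_sub (hKb.integrable π) (integrable_const a)]; simp [ha]
  obtain ⟨B, hB, hsq⟩ := H.integral_sq_sum_le (Ω := Ω) hπ hg hg0 (ε := ε ^ 2 / 4) (by positivity)
  refine ⟨((2 * c) ^ 2 + B) / ε, by positivity, fun P _ ℱ 𝒢 X ξ x hx hX hξ t => ?_⟩
  rcases Nat.eq_zero_or_pos t with rfl | ht
  · simp; positivity
  have ht' : (1 : ℝ) ≤ t := by exact_mod_cast ht
  have hd : ∀ u, BddMeas (fun ω => b (ξ u ω) - transfer K b (X u ω)) (c + c) := fun u =>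
    (hb.comp (hξ.measurable u)).sub (hKb.comp (hξ.measurable_left u))
  have he : ∀ u, BddMeas (fun ω => transfer K b (X u ω) - a) (c + |a|) := fun u =>
    hg.comp (hξ.measurable_left u)
  have hds := BddMeas.sum (Finset.range t) hd
  have hes := BddMeas.sum (Finset.range t) he
  have h1 := hξ.integral_sq_sum_le hb t
  have h2 := hsq P ℱ X x hx hX t
  have hds2 := (hds.mul hds).integrable P
  have hes2 := (hes.mul hes).integrable P
  simp_rw [sq (∑ u ∈ _, _)] at h1 h2
  have hεt : 0 < ε * t := by positivity
  -- From `|z| ≤ z ^ 2 / (2 ε t) + ε t / 2` and `(D + E) ^ 2 ≤ 2 D ^ 2 + 2 E ^ 2`. With the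
  -- second-moment accuracy `ε ^ 2 / 4` the linear terms add up to `3 ε t / 4`.
  have hpt : ∀ D E : ℝ, |D + E| ≤ (ε * t)⁻¹ * (D * D) + (ε * t)⁻¹ * (E * E) + ε * t / 2 := by
    intro D E
    rw [← mul_add, ← sub_le_iff_le_add, inv_mul_eq_div, le_div_iff₀ hεt]
    nlinarith [sq_nonneg (D - E), sq_nonneg (|D + E| - ε * t), sq_abs (D + E)]
  have hsplit : ∀ ω, ∑ u ∈ Finset.range t, (b (ξ u ω) - a) =
      ∑ u ∈ Finset.range t, (b (ξ u ω) - transfer K b (X u ω)) +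
      ∑ u ∈ Finset.range t, (transfer K b (X u ω) - a) := fun ω => by
    rw [← Finset.sum_add_distrib]
    exact Finset.sum_congr rfl fun u _ => by ring
  simp_rw [hsplit]
  have hI1 := hds2.const_mul (ε * t)⁻¹
  have hI2 := hes2.const_mul (ε * t)⁻¹
  refine (integral_mono (((hds.add hes).abs).integrable P) ((hI1.fun_add hI2).fun_add
    (integrable_const (ε * t / 2))) fun ω => hpt _ _).trans ?_
  rw [integral_add (hI1.fun_add hI2) (integrable_const _), integral_add hI1 hI2, integral_const_mul,
    integral_const_mul, integral_const, probReal_univ, one_smul, ← mul_add]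
  refine (add_le_add_left (mul_le_mul_of_nonneg_left (add_le_add h1 h2)
    (inv_nonneg.2 hεt.le)) _).trans ?_
  have h3 : (ε * t)⁻¹ * ((2 * c) ^ 2 * t + (B + ε ^ 2 / 4 * t ^ 2)) =
      (2 * c) ^ 2 / ε + B / ε / t + ε * t / 4 := by
    field_simp
    ring
  have h4 : B / ε / t ≤ B / ε := div_le_self (by positivity) ht'
  rw [h3, add_div]
  linarith

end Sampled

/-! ### Pathwise estimates -/

/-- A non-negative sequence whose increments are dominated by `ξ t + h (ℓ t)` is controlled by the
sums of `ξ` since its last visit to `[0, R]`. -/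
lemma exists_le_sum_Ico {ℓ ξ : ℕ → ℝ} {h : ℝ → ℝ} {R ε : ℝ} (hR : 0 ≤ R) (hℓ : ∀ t, 0 ≤ ℓ t)
    (h0 : ∀ x, 0 ≤ x → 0 ≤ h x) (hanti : AntitoneOn h (Set.Ici 0)) (hRε : h R ≤ ε)
    (hinc : ∀ t, ℓ (t + 1) - ℓ t ≤ ξ t + h (ℓ t)) (t : ℕ) :
    ∃ s ≤ t, ℓ t - ℓ 0 ≤ R + h 0 + ∑ u ∈ Finset.Ico s t, (ξ u + ε) := by
  have hh0 := h0 0 le_rfl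
  have hε : 0 ≤ ε := (h0 R hR).trans hRε
  induction t with
  | zero => exact ⟨0, le_rfl, by simp; linarith⟩
  | succ t ih =>
    obtain ⟨s, hs, hle⟩ := ih
    have hi := hinc t
    rcases le_total (ℓ t) R with hlt | hlt
    -- A visit to `[0, R]` restarts the count: the next value is at most `R + h 0 + ξ t`. If no
    -- visit has occurred, `s` is still `0`.
    · refine ⟨t, t.le_succ, ?_⟩
      have := hanti Set.self_mem_Ici (hℓ t) (hℓ t)
      simp only [Nat.Ico_succ_singleton, Finset.sum_singleton]
      linarith [hℓ 0]
    · refine ⟨s, hs.trans t.le_succ, ?_⟩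
      have := hanti hR (hℓ t) hlt
      rw [Finset.sum_Ico_succ_top hs]
      linarith

/-- The increments of the partial sums of a bounded sequence are controlled by the partial sums at
`J` equally spaced times. -/
lemma sum_Ico_le_blocks {a : ℕ → ℝ} {c : ℝ} (hc0 : 0 ≤ c) (ha : ∀ u, |a u| ≤ c) {s t J : ℕ}
    (hst : s ≤ t) (hJ : 0 < J) : ∑ u ∈ Finset.Ico s t, a u ≤ c * (t / J + 1) + |∑ u ∈ Finset.range t, a u| +
      ∑ j ∈ Finset.range J, |∑ u ∈ Finset.range (min ((t / J + 1) * j) t), a u| := by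
  -- Block length: with the `+ 1` it is positive and `J` blocks reach beyond `t`. The sum from `s`
  -- differs from the one starting at the preceding grid point by less than a block.
  set n := t / J + 1 with hn
  have hn0 : 0 < n := Nat.succ_pos _
  have hs' : n * (s / n) ≤ s := Nat.mul_div_le s n
  have hj : s / n < J := by
    rw [Nat.div_lt_iff_lt_mul hn0]
    have := Nat.lt_mul_div_succ t hJ
    exact hst.trans_lt this
  have hsum := Finset.single_le_sum
    (f := fun j => |∑ u ∈ Finset.range (min (n * j) t), a u|)
    (fun j _ => abs_nonneg _) (Finset.mem_range.2 hj)
  -- The minimum is inactive at the grid point before `s`; elsewhere it keeps the times below `t`.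
  simp only [min_eq_left (hs'.trans hst)] at hsum
  have hblock : |∑ u ∈ Finset.Ico (n * (s / n)) s, a u| ≤ c * (t / J + 1) := by
    refine (Finset.abs_sum_le_sum_abs _ _).trans ((Finset.sum_le_sum fun u _ => ha u).trans ?_)
    rw [Finset.sum_const, Nat.card_Ico, nsmul_eq_mul, mul_comm]
    refine mul_le_mul_of_nonneg_left ?_ hc0
    have h1 : s - n * (s / n) ≤ n := by
      rw [← Nat.mod_eq_sub_mul_div]; exact (Nat.mod_lt s hn0).le
    calc ((s - n * (s / n) : ℕ) : ℝ) ≤ n := by exact_mod_cast h1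
      _ = ((t / J : ℕ) : ℝ) + 1 := by rw [hn]; push_cast; rfl
      _ ≤ t / J + 1 := by gcongr; exact Nat.cast_div_le
  have e1 := Finset.sum_range_add_sum_Ico a hs'
  have e2 := Finset.sum_range_add_sum_Ico a hst
  have := abs_le.1 hblock
  linarith [le_abs_self (∑ u ∈ Finset.range t, a u),
    neg_abs_le (∑ u ∈ Finset.range (n * (s / n)), a u), this.1]

/-! ### Truncation -/

/-- The function `r ↦ r` truncated to zero outside `(-C, C)`. -/
noncomputable def truncAt (C r : ℝ) : ℝ := if |r| < C then r else 0

lemma truncAt_bddMeas {C : ℝ} (hC : 0 ≤ C) : BddMeas (truncAt C) C := by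
  refine ⟨Measurable.ite (measurableSet_lt measurable_id.abs measurable_const) measurable_id
    measurable_const, fun r => ?_⟩
  unfold truncAt
  split_ifs with h
  · exact h.le
  · simpa using hC

lemma measurable_sub_truncAt (C : ℝ) : Measurable fun r => r - truncAt C r :=
  measurable_id.sub (Measurable.ite (measurableSet_lt measurable_id.abs measurable_const)
    measurable_id measurable_const)

/-- The distributions `K x` are uniformly integrable. -/
def HasUniformTails {S : Type*} [MeasurableSpace S] (K : Kernel S ℝ) : Prop :=
  ∀ δ : ℝ, 0 < δ → ∃ C : ℝ, 0 ≤ C ∧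
    ∀ x, ∫⁻ r, ‖r - truncAt C r‖ₑ ∂(K x) ≤ ENNReal.ofReal δ

section Tail

variable {S Ω : Type*} [MeasurableSpace S] [MeasurableSpace Ω] {K : Kernel S ℝ} [IsMarkovKernel K]
  {C δ : ℝ}

lemma abs_mean_sub_transfer_le (hC : 0 ≤ C) (hδ : 0 ≤ δ) (x : S)
    (htail : ∫⁻ r, ‖r - truncAt C r‖ₑ ∂(K x) ≤ ENNReal.ofReal δ) :
    |∫ r, r ∂(K x) - transfer K (truncAt C) x| ≤ δ := by
  have hi : Integrable (fun r => r - truncAt C r) (K x) :=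
    ⟨(measurable_sub_truncAt C).aestronglyMeasurable, htail.trans_lt ENNReal.ofReal_lt_top⟩
  have hb := (truncAt_bddMeas hC).integrable (K x)
  have hid : Integrable (fun r : ℝ => r) (K x) := by
    simpa using hi.fun_add hb
  rw [transfer, ← integral_sub hid hb]
  refine abs_integral_le_integral_abs.trans ?_
  have := integral_norm_eq_lintegral_enorm hi.aestronglyMeasurable
  simp only [Real.norm_eq_abs] at this
  rw [this]
  exact ENNReal.toReal_le_of_le_ofReal hδ htail

lemma integral_transfer_truncAt_le {π : Measure S} [IsProbabilityMeasure π] (hC : 0 ≤ C)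
    (hδ : 0 ≤ δ) (htail : ∀ x, ∫⁻ r, ‖r - truncAt C r‖ₑ ∂(K x) ≤ ENNReal.ofReal δ)
    (hneg : ∫ x, (∫ r, r ∂(K x)) ∂π < 0) : ∫ x, transfer K (truncAt C) x ∂π ≤ δ := by
  have hint : Integrable (fun x => ∫ r, r ∂(K x)) π := by
    -- A non-integrable mean would have integral `0` by convention, contradicting negativity.
    by_contra h
    rw [integral_undef h] at hneg
    exact lt_irrefl _ hneg
  have : ∫ x, transfer K (truncAt C) x ∂π ≤ ∫ x, ((∫ r, r ∂(K x)) + δ) ∂π := by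
    refine integral_mono (((truncAt_bddMeas hC).transfer K).integrable π)
      (hint.fun_add (integrable_const δ)) fun x => ?_
    have := (abs_le.1 (abs_mean_sub_transfer_le hC hδ x (htail x))).1
    simp only
    linarith
  rw [integral_add hint (integrable_const δ)] at this
  simp only [integral_const, probReal_univ, one_smul] at this
  linarith

namespace IsSampledFrom

variable {P : Measure Ω} [IsProbabilityMeasure P] {𝒢 : ℕ → MeasurableSpace Ω} {X : ℕ → Ω → S}
  {ξ : ℕ → Ω → ℝ}

omit [IsMarkovKernel K] in
lemma lintegral_sub_truncAt_le (h : IsSampledFrom K P 𝒢 X ξ)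
    (htail : ∀ x, ∫⁻ r, ‖r - truncAt C r‖ₑ ∂(K x) ≤ ENNReal.ofReal δ) (t : ℕ) :
    ∫⁻ ω, ‖ξ t ω - truncAt C (ξ t ω)‖ₑ ∂P ≤ ENNReal.ofReal δ := by
  rw [h.lintegral_comp (f := fun r => ‖r - truncAt C r‖ₑ) (measurable_sub_truncAt C).enorm t]
  exact (lintegral_mono fun ω => htail (X t ω)).trans (by simp)

omit [IsMarkovKernel K] in
lemma integrable_sub_truncAt (h : IsSampledFrom K P 𝒢 X ξ)
    (htail : ∀ x, ∫⁻ r, ‖r - truncAt C r‖ₑ ∂(K x) ≤ ENNReal.ofReal δ) (t : ℕ) :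
    Integrable (fun ω => ξ t ω - truncAt C (ξ t ω)) P :=
  ⟨((measurable_sub_truncAt C).comp (h.measurable t)).aestronglyMeasurable,
    (h.lintegral_sub_truncAt_le htail t).trans_lt ENNReal.ofReal_lt_top⟩

omit [IsMarkovKernel K] in
lemma integral_abs_sub_truncAt_le (h : IsSampledFrom K P 𝒢 X ξ) (hδ : 0 ≤ δ)
    (htail : ∀ x, ∫⁻ r, ‖r - truncAt C r‖ₑ ∂(K x) ≤ ENNReal.ofReal δ) (t : ℕ) :
    ∫ ω, |ξ t ω - truncAt C (ξ t ω)| ∂P ≤ δ := by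
  have := integral_norm_eq_lintegral_enorm (h.integrable_sub_truncAt htail t).aestronglyMeasurable
  simp only [Real.norm_eq_abs] at this
  rw [this]
  exact ENNReal.toReal_le_of_le_ofReal hδ (h.lintegral_sub_truncAt_le htail t)

omit [IsMarkovKernel K] in
lemma integrable (h : IsSampledFrom K P 𝒢 X ξ) (hK : HasUniformTails K) (t : ℕ) :
    Integrable (ξ t) P := by
  obtain ⟨C, hC, htail⟩ := hK 1 one_pos
  simpa using (h.integrable_sub_truncAt htail t).fun_add
    (((truncAt_bddMeas hC).comp (h.measurable t)).integrable P)

end IsSampledFrom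

end Tail

/-! ### The drift estimate -/

/-- A non-negative process whose increments are dominated by sampled variables with a negative
stationary mean grows sublinearly in expectation, uniformly over the starting points in `V`. -/
theorem IsPetiteRecurrent.integral_sub_start_le {S Ω : Type*} [MeasurableSpace S]
    [MeasurableSpace Ω] {K : Kernel S ℝ} [IsMarkovKernel K]
    {Q : Kernel S S} [IsMarkovKernel Q] {V : Set S} {μ : Measure S} [IsProbabilityMeasure μ]
    {p C : ℝ} {m : ℕ} (H : IsPetiteRecurrent Q V μ p C m) {π : Measure S}
    [IsProbabilityMeasure π] (hπ : Kernel.Invariant Q π) (hK : HasUniformTails K)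
    (hneg : ∫ x, (∫ r, r ∂(K x)) ∂π < 0) {h : ℝ → ℝ} (h0 : ∀ x, 0 ≤ x → 0 ≤ h x)
    (hanti : AntitoneOn h (Set.Ici 0)) (hlim : Tendsto h atTop (𝓝 0)) {ε : ℝ} (hε : 0 < ε) :
    ∃ B : ℝ, ∀ (P : Measure Ω) [IsProbabilityMeasure P] (ℱ 𝒢 : ℕ → MeasurableSpace Ω)
      (X : ℕ → Ω → S) (ξ ℓ : ℕ → Ω → ℝ) (x : S), x ∈ V → IsChainFrom Q P ℱ X x →
      IsSampledFrom K P 𝒢 X ξ → (∀ t ω, 0 ≤ ℓ t ω) → (∀ t, Integrable (ℓ t) P) →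
      (∀ t, ∀ᵐ ω ∂P, ℓ (t + 1) ω - ℓ t ω ≤ ξ t ω + h (ℓ t ω)) →
      ∀ t : ℕ, ∫ ω, (ℓ t ω - ℓ 0 ω) ∂P ≤ B + ε * t := by
  -- The five shares: the bound on `h` above `R`, the truncated mean, the truncation error, the
  -- partial block, and the law of large numbers at `J + 1` times with accuracy `δ / (J + 1)` each.
  obtain ⟨δ, hδ, rfl⟩ : ∃ δ > 0, ε = 5 * δ := ⟨ε / 5, by positivity, by ring⟩
  obtain ⟨R, hRδ, hR⟩ := ((hlim.eventually (ge_mem_nhds hδ)).and (eventually_ge_atTop 0)).exists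
  obtain ⟨c, hc, htail⟩ := hK δ hδ
  have hb := truncAt_bddMeas hc
  have ha := integral_transfer_truncAt_le hc hδ.le htail hneg
  have ha' := (hb.transfer K).abs_integral_le π
  set a := ∫ x, transfer K (truncAt c) x ∂π with hadef
  obtain ⟨J, hJ⟩ := exists_nat_gt (2 * c / δ)
  have hJ0 : (0 : ℝ) < J := lt_of_le_of_lt (by positivity) hJ
  have hJδ : 2 * c / J ≤ δ := by
    rw [div_lt_iff₀ hδ] at hJ
    rw [div_le_iff₀ hJ0]
    linarith
  have hη : 0 < δ / (J + 1) := by positivity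
  obtain ⟨B, hB, hLLN⟩ := H.integral_abs_sum_le (Ω := Ω) (K := K) hπ hb hη
  refine ⟨R + h 0 + 2 * c + (J + 1) * B,
    fun P _ ℱ 𝒢 X ξ ℓ x hx hX hξ hℓ hℓi hinc t => ?_⟩
  set A : ℕ → Ω → ℝ := fun r ω => |∑ u ∈ Finset.range r, (truncAt c (ξ u ω) - a)| with hA
  have hdev : ∀ u, BddMeas (fun ω => truncAt c (ξ u ω) - a) (c + |a|) := fun u =>
    (hb.comp (hξ.measurable u)).sub (BddMeas.const a)
  have hAi : ∀ r, Integrable (A r) P := fun r => (BddMeas.sum _ hdev).abs.integrable P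
  have hAle : ∀ r ≤ t, ∫ ω, A r ω ∂P ≤ B + δ / (J + 1) * t := fun r hr =>
    (hLLN P ℱ 𝒢 X ξ x hx hX hξ r).trans (by gcongr)
  set E : ℕ → Ω → ℝ := fun u ω => |ξ u ω - truncAt c (ξ u ω)| with hE
  have hEi : ∀ u, Integrable (E u) P := fun u => (hξ.integrable_sub_truncAt htail u).abs
  set k : ℝ := R + h 0 + (2 * δ) * t + 2 * c * (t / J + 1) with hk
  have hpath : ∀ᵐ ω ∂P, ℓ t ω - ℓ 0 ω ≤ k + (∑ u ∈ Finset.range t, E u ω + (A t ω +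
      ∑ j ∈ Finset.range J, A (min ((t / J + 1) * j) t) ω)) := by
    filter_upwards [ae_all_iff.2 hinc] with ω hω
    obtain ⟨s, hs, hle⟩ := exists_le_sum_Ico (ℓ := fun t => ℓ t ω) (ξ := fun t => ξ t ω) hR
      (fun t => hℓ t ω) h0 hanti hRδ hω t
    have hblock := sum_Ico_le_blocks (a := fun u => truncAt c (ξ u ω) - a) (c := 2 * c)
      (by positivity) (fun u => ((hdev u).abs_le ω).trans (by linarith)) hs
      (J := J) (by exact_mod_cast hJ0)
    have hsplit : ∑ u ∈ Finset.Ico s t, (ξ u ω + δ) ≤ ∑ u ∈ Finset.Ico s t, E u ω +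
        ∑ u ∈ Finset.Ico s t, (truncAt c (ξ u ω) - a) + ∑ u ∈ Finset.Ico s t, (2 * δ) := by
      rw [← Finset.sum_add_distrib, ← Finset.sum_add_distrib]
      refine Finset.sum_le_sum fun u _ => ?_
      have := le_abs_self (ξ u ω - truncAt c (ξ u ω))
      simp only [hE]
      linarith
    have hEs : ∑ u ∈ Finset.Ico s t, E u ω ≤ ∑ u ∈ Finset.range t, E u ω :=
      Finset.sum_le_sum_of_subset_of_nonneg
        (fun u hu => Finset.mem_range.2 (Finset.mem_Ico.1 hu).2) fun u _ _ => abs_nonneg _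
    have hconst : ∑ u ∈ Finset.Ico s t, (2 * δ) ≤ (2 * δ) * t := by
      rw [Finset.sum_const, Nat.card_Ico, nsmul_eq_mul, mul_comm]
      gcongr
      exact_mod_cast Nat.sub_le t s
    simp only [hA, hk]
    linarith
  have hI1 := integrable_finsetSum (Finset.range t) fun u _ => hEi u
  have hI2 := integrable_finsetSum (Finset.range J) fun j _ => hAi (min ((t / J + 1) * j) t)
  have hI3 := (hAi t).fun_add hI2
  refine (integral_mono_ae ((hℓi t).sub (hℓi 0))
    ((integrable_const k).fun_add (hI1.fun_add hI3)) hpath).trans ?_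
  rw [integral_add (integrable_const k) (hI1.fun_add hI3), integral_add hI1 hI3,
    integral_add (hAi t) hI2, integral_finsetSum _ fun u _ => hEi u,
    integral_finsetSum _ fun j _ => hAi _, integral_const, probReal_univ, one_smul]
  have h1 : ∑ u ∈ Finset.range t, ∫ ω, E u ω ∂P ≤ t * δ := by
    refine (Finset.sum_le_sum fun u _ => hξ.integral_abs_sub_truncAt_le hδ.le htail u).trans ?_
    simp
  have h2 : ∑ j ∈ Finset.range J, ∫ ω, A (min ((t / J + 1) * j) t) ω ∂P ≤
      J * (B + δ / (J + 1) * t) := by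
    refine (Finset.sum_le_sum fun j _ => hAle _ (min_le_right _ _)).trans ?_
    rw [Finset.sum_const, Finset.card_range, nsmul_eq_mul]
  have h3 := hAle t le_rfl
  have h4 : (J + 1) * (B + δ / (J + 1) * t) = (J + 1) * B + δ * t := by field_simp
  have h5 : 2 * c * (t / J + 1) ≤ δ * t + 2 * c := by
    have := mul_le_mul_of_nonneg_right hJδ (Nat.cast_nonneg (α := ℝ) t)
    have e : 2 * c * (t / J + 1) = 2 * c / J * t + 2 * c := by ring
    linarith
  simp only [hk]
  linarith

/-! ### Verification of the hypotheses -/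

section Verification

variable {𝒳 𝒴 Ω : Type*} [MeasurableSpace 𝒳] [MeasurableSpace 𝒴] [MeasurableSpace Ω]
  {κ : Kernel (𝒳 × 𝒴) (𝒳 × 𝒴)} [IsMarkovKernel κ] {Q : Kernel 𝒳 𝒳} {P : 𝒳 × 𝒴 → Measure Ω}
  {X : ℕ → Ω → 𝒳} {Y : ℕ → Ω → 𝒴} {V : Set 𝒳}

lemma isMarkovKernel_of_autonomous [Nonempty 𝒴]
    (h : ∀ x y, (κ (x, y)).map Prod.fst = Q x) : IsMarkovKernel Q := by
  obtain ⟨y⟩ := ‹Nonempty 𝒴›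
  exact ⟨fun x => h x y ▸ Measure.isProbabilityMeasure_map measurable_fst.aemeasurable⟩

omit [IsMarkovKernel κ] in
/-- An autonomous component of a Markov chain is a Markov chain. -/
lemma IsMarkovFamily.isChainFrom (hZ : IsMarkovFamily κ P fun t ω => (X t ω, Y t ω))
    (h : ∀ x y, (κ (x, y)).map Prod.fst = Q x) (x : 𝒳) (y : 𝒴) :
    IsChainFrom Q (P (x, y)) (fun t => ⨆ s ≤ t, MeasurableSpace.comap
      (fun ω => (X s ω, Y s ω)) inferInstance) X x where
  le t := iSup₂_le fun s _ => (hZ.measurable s).comap_le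
  mono _ _ hst := biSup_mono fun _ hr => hr.trans hst
  adapted t := measurable_fst.comp (Measurable.of_comap_le
    (le_iSup₂ (f := fun s (_ : s ≤ t) => MeasurableSpace.comap
      (fun ω => (X s ω, Y s ω)) inferInstance) t le_rfl))
  start := by
    have := congrArg (Measure.map Prod.fst) (hZ.start (x, y))
    rwa [Measure.map_map measurable_fst (hZ.measurable 0),
      Measure.map_dirac' measurable_fst] at this
  markov t A B hA hB := by
    refine (hZ.markov (x, y) t A (Prod.fst ⁻¹' B) hA (measurable_fst hB)).trans ?_
    refine lintegral_congr fun ω => ?_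
    rw [← h (X t ω) (Y t ω), Measure.map_apply measurable_fst hB]

omit [IsMarkovKernel κ] in
-- Autonomy turns statements about `P (x, y)` into statements about `Q` alone, so any single `y`
-- serves.
lemma ConditionA.exists_isPetiteRecurrent [Nonempty 𝒴] [IsMarkovKernel Q]
    (hZ : IsMarkovFamily κ P fun t ω => (X t ω, Y t ω)) (hA : ConditionA κ Q P X V) :
    ∃ (μ : Measure 𝒳) (p C : ℝ) (m : ℕ), IsProbabilityMeasure μ ∧
      IsPetiteRecurrent Q V μ p C m := by
  obtain ⟨y⟩ := ‹Nonempty 𝒴›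
  obtain ⟨p, μ, m, hp, -, hμ, -, hmin⟩ := hA.petite
  refine ⟨μ, p, (⨆ x ∈ V, ⨆ y, ∫⁻ ω, (returnTime X V ω : ℝ≥0∞) ∂(P (x, y))).toReal, m, hμ, hA.measurableSet, hp,
    ENNReal.toReal_nonneg, ?_, ?_, fun x hx n => ?_⟩
  · intro x hx g c hg hg0
    have := hZ.isProbability (x, y)
    have hX := hZ.isChainFrom hA.autonomous x y
    have hle : ENNReal.ofReal p • μ ≤ (P (x, y)).map (X m) := by
      refine Measure.le_iff.2 fun B hB => ?_
      rw [Measure.map_apply (hX.measurable m) hB]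
      exact hmin x hx y B hB
    have hprob := Measure.isProbabilityMeasure_map (μ := P (x, y)) (hX.measurable m).aemeasurable
    have := integral_mono_measure hle (ae_of_all _ hg0) (hg.integrable _)
    rwa [integral_smul_measure, ENNReal.toReal_ofReal hp.le, smul_eq_mul,
      integral_map (hX.measurable m).aemeasurable hg.meas.aestronglyMeasurable,
      hX.integral_comp hg] at this
  · intro x
    have := hZ.isProbability (x, y)
    exact (hZ.isChainFrom hA.autonomous x y).tendsto_avoidProb hA.measurableSet (hA.recurrent x y)
  · have := hZ.isProbability (x, y)
    refine (ENNReal.ofReal_le_iff_le_toReal hA.positive.ne).1 ?_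
    refine ((hZ.isChainFrom hA.autonomous x y).sum_avoidProb_le hA.measurableSet n).trans ?_
    exact (le_iSup (fun y => ∫⁻ ω, (returnTime X V ω : ℝ≥0∞) ∂(P (x, y))) y).trans
      (le_iSup₂ (f := fun x (_ : x ∈ V) => ⨆ y, ∫⁻ ω, (returnTime X V ω : ℝ≥0∞) ∂(P (x, y))) x hx)

omit [IsMarkovKernel κ] in
-- Needed because a supremum over an empty `V` would be `⊥` in the extended reals.
lemma ConditionA.nonempty [Nonempty 𝒴] [Nonempty 𝒳]
    (hZ : IsMarkovFamily κ P fun t ω => (X t ω, Y t ω)) (hA : ConditionA κ Q P X V) :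
    V.Nonempty := by
  obtain ⟨x⟩ := ‹Nonempty 𝒳›
  obtain ⟨y⟩ := ‹Nonempty 𝒴›
  have := hZ.isProbability (x, y)
  obtain ⟨ω, hω⟩ := (hA.recurrent x y).exists
  obtain ⟨t, ht⟩ := iInf_lt_iff.1 hω
  obtain ⟨h, -⟩ := iInf_lt_iff.1 ht
  exact ⟨_, h.2⟩

end Verification

/-! ### Sampling kernel, uniform tails and integrability from the domination condition -/

namespace IsDominated

variable {𝒳 S Ω : Type*} [MeasurableSpace 𝒳] [MeasurableSpace Ω] {P : S → Measure Ω}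
  {X : ℕ → Ω → 𝒳} {π : Measure 𝒳} {ℓ : ℕ → Ω → ℝ} {h : ℝ → ℝ} {φ : ℕ → 𝒳 → Ω → ℝ}
  {F : 𝒳 → Measure ℝ}

lemma isProbabilityMeasure (hD : IsDominated P X π ℓ h φ F) (z : S) [IsProbabilityMeasure (P z)]
    (x : 𝒳) : IsProbabilityMeasure (F x) :=
  hD.law z 0 x ▸ Measure.isProbabilityMeasure_map (hD.measurable 0 x).aemeasurable

lemma measurable_dist (hD : IsDominated P X π ℓ h φ F) (z : S) [IsProbabilityMeasure (P z)] :
    Measurable F := by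
  have := hD.isProbabilityMeasure z
  refine .measure_of_isPiSystem_of_isProbabilityMeasure (borel_eq_generateFrom_Iic ℝ)
    isPiSystem_Iic ?_
  rintro _ ⟨r, rfl⟩
  exact hD.cdf_measurable r

/-- The distributions of the dominating variables, as a kernel. -/
noncomputable def kernel (hD : IsDominated P X π ℓ h φ F) (z : S) [IsProbabilityMeasure (P z)] :
    Kernel 𝒳 ℝ := ⟨F, hD.measurable_dist z⟩

lemma isMarkovKernel (hD : IsDominated P X π ℓ h φ F) (z : S) [IsProbabilityMeasure (P z)] :
    IsMarkovKernel (hD.kernel z) := ⟨hD.isProbabilityMeasure z⟩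

lemma hasUniformTails (hD : IsDominated P X π ℓ h φ F) (z : S) [IsProbabilityMeasure (P z)] :
    HasUniformTails (hD.kernel z) := by
  intro δ hδ
  -- Time `0` suffices, since the laws do not depend on time. The error `r - truncAt C r` is `r`
  -- restricted to `C ≤ |r|`, exactly the tail in uniform integrability.
  obtain ⟨C, hC⟩ := (hD.unifIntegrable z 0).spec one_ne_zero ENNReal.one_ne_top hδ
  refine ⟨C, C.2, fun x => ?_⟩
  change ∫⁻ r, ‖r - truncAt C r‖ₑ ∂(F x) ≤ _
  rw [← hD.law z 0 x, lintegral_map (measurable_sub_truncAt C).enorm (hD.measurable 0 x)]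
  refine le_trans (le_of_eq ?_) (hC x)
  rw [eLpNorm_one_eq_lintegral_enorm]
  refine lintegral_congr fun ω => ?_
  congr 1
  have hiff : ω ∈ {ω | C ≤ ‖φ 0 x ω‖₊} ↔ (C : ℝ) ≤ |φ 0 x ω| := by
    rw [Set.mem_ofPred_eq, ← NNReal.coe_le_coe, coe_nnnorm, Real.norm_eq_abs]
  unfold truncAt
  by_cases hω : (C : ℝ) ≤ |φ 0 x ω|
  · rw [Set.indicator_of_mem (hiff.2 hω), if_neg (not_lt.2 hω), sub_zero]
  · rw [Set.indicator_of_notMem (fun h => hω (hiff.1 h)), if_pos (not_le.1 hω), sub_self]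

/-- The starting point `z₀` serves only to make `F` a kernel; the same kernel then works under every
`P z`, which keeps later constants uniform. -/
lemma isSampledFrom (hD : IsDominated P X π ℓ h φ F) (hX : ∀ t, Measurable (X t)) (z₀ z : S)
    [IsProbabilityMeasure (P z₀)] :
    IsSampledFrom (hD.kernel z₀) (P z) (pastSigma X fun s ω => φ s (X s ω) ω) X
      (fun t ω => φ t (X t ω) ω) where
  le _ := sup_le (iSup₂_le fun s _ => (hX s).comap_le)
    (iSup₂_le fun s _ => (hD.subst_measurable s).comap_le)
  mono _ _ hst := sup_le_sup (biSup_mono fun _ hr => hr.trans hst)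
    (biSup_mono fun _ hr => lt_of_lt_of_le hr hst)
  adapted t := (comap_measurable _).mono
    (le_sup_of_le_left (le_iSup₂_of_le t le_rfl le_rfl)) le_rfl
  measurable_succ t := (comap_measurable _).mono
    (le_sup_of_le_right (le_iSup₂_of_le t t.lt_succ_self le_rfl)) le_rfl
  law t A B hA hB := hD.subst_law z t A B hA hB

/-- Induction on `0 ≤ ℓ (t + 1) ≤ ℓ t + |ξ t| + h 0`, with `ξ t` integrable by its uniform tails. -/
lemma integrable (hD : IsDominated P X π ℓ h φ F) (hX : ∀ t, Measurable (X t))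
    (hℓ : ∀ t ω, 0 ≤ ℓ t ω) (hℓm : ∀ t, Measurable (ℓ t)) (z : S) [IsProbabilityMeasure (P z)]
    (h0 : Integrable (ℓ 0) (P z)) (t : ℕ) : Integrable (ℓ t) (P z) := by
  induction t with
  | zero => exact h0
  | succ t ih =>
    have hξ := (hD.isSampledFrom hX z z).integrable (hD.hasUniformTails z) t
    refine Integrable.mono' ((ih.add hξ.abs).add (integrable_const (h 0)))
      (hℓm (t + 1)).aestronglyMeasurable ?_
    filter_upwards [hD.increment_le z t] with ω hω
    have := hD.h_antitone Set.self_mem_Ici (hℓ t ω) (hℓ t ω)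
    rw [Real.norm_eq_abs, abs_of_nonneg (hℓ _ ω)]
    simp only [Pi.add_apply]
    linarith [le_abs_self (φ t (X t ω) ω)]

end IsDominated

/-- A supremum over late times of quantities that are sublinear from above, and bounded below for
a fixed parameter, tends to zero after division by the time. -/
lemma tendsto_iSup_div_zero {𝒳 𝒴 : Type*} {V : Set 𝒳} {f : 𝒳 → 𝒴 → ℕ → ℝ}
    (hV : V.Nonempty) [Nonempty 𝒴] (hlower : ∀ x y, ∃ b : ℝ, ∀ t, b ≤ f x y t)
    (hupper : ∀ ε : ℝ, 0 < ε → ∃ B : ℝ, ∀ x ∈ V, ∀ y, ∀ t : ℕ, f x y t ≤ B + ε * t) :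
    Tendsto (fun N : ℕ => ⨆ t ≥ N, ⨆ y, ⨆ x ∈ V, ((f x y t / (t : ℝ) : ℝ) : EReal))
      atTop (𝓝 0) := by
  obtain ⟨x₀, hx₀⟩ := hV
  obtain ⟨y₀⟩ := ‹Nonempty 𝒴›
  refine tendsto_order.2 ⟨fun a ha => Eventually.of_forall fun N => ?_, fun a ha => ?_⟩
  -- For the lower bound one pair `(x₀, y₀)` and one late time suffice.
  · obtain ⟨r, har, hr⟩ := EReal.lt_iff_exists_real_btwn.1 ha
    have hr0 : r < 0 := by exact_mod_cast hr
    obtain ⟨b, hb⟩ := hlower x₀ y₀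
    have hlim : Tendsto (fun t : ℕ => b / (t : ℝ)) atTop (𝓝 0) :=
      tendsto_const_div_atTop_nhds_zero_nat b
    obtain ⟨t, ht, htN⟩ := ((hlim.eventually (lt_mem_nhds hr0)).and
      (eventually_ge_atTop N)).exists
    refine har.trans_le ?_
    have h1 : (r : EReal) ≤ ((f x₀ y₀ t / (t : ℝ) : ℝ) : EReal) := by
      refine EReal.coe_le_coe_iff.2 (ht.le.trans ?_)
      gcongr
      exact hb t
    refine h1.trans (le_trans ?_ (le_iSup₂ (f := fun t (_ : t ≥ N) =>
      ⨆ y, ⨆ x ∈ V, ((f x y t / (t : ℝ) : ℝ) : EReal)) t htN))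
    exact le_trans (le_iSup₂ (f := fun x (_ : x ∈ V) =>
      ((f x y₀ t / (t : ℝ) : ℝ) : EReal)) x₀ hx₀)
      (le_iSup (fun y => ⨆ x ∈ V, ((f x y t / (t : ℝ) : ℝ) : EReal)) y₀)
  · obtain ⟨r, hr, hra⟩ := EReal.lt_iff_exists_real_btwn.1 ha
    have hr0 : 0 < r := by exact_mod_cast hr
    -- Half of `r` is for the slope, half for `B / t`.
    obtain ⟨B, hB⟩ := hupper (r / 2) (by positivity)
    have hlim : Tendsto (fun t : ℕ => B / (t : ℝ)) atTop (𝓝 0) :=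
      tendsto_const_div_atTop_nhds_zero_nat B
    obtain ⟨N₀, hN₀⟩ := eventually_atTop.1
      ((hlim.eventually (ge_mem_nhds (half_pos hr0))).and (eventually_gt_atTop 0))
    filter_upwards [eventually_ge_atTop N₀] with N hN
    refine lt_of_le_of_lt ?_ hra
    refine iSup₂_le fun t ht => iSup_le fun y => iSup₂_le fun x hx => EReal.coe_le_coe_iff.2 ?_
    obtain ⟨h1, h2⟩ := hN₀ t (hN.trans ht)
    have h2' : (0 : ℝ) < t := by exact_mod_cast h2
    rw [div_le_iff₀ h2'] at h1 ⊢
    linarith [hB x hx y t]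

theorem lemma3 {M : ℕ} {𝒳 Ω : Type*} {𝒴 : Fin M → Type*}
    [MeasurableSpace 𝒳] [MeasurableSpace.CountablyGenerated 𝒳]
    [∀ i, MeasurableSpace (𝒴 i)] [∀ i, MeasurableSpace.CountablyGenerated (𝒴 i)]
    [∀ i, Nonempty (𝒴 i)] [MeasurableSpace Ω]
    (κ : Kernel (𝒳 × (∀ i, 𝒴 i)) (𝒳 × (∀ i, 𝒴 i))) [IsMarkovKernel κ]
    (P : 𝒳 × (∀ i, 𝒴 i) → Measure Ω) (X : ℕ → Ω → 𝒳) (Y : ℕ → Ω → ∀ i, 𝒴 i)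
    (hZ : IsMarkovFamily κ P (fun t ω => (X t ω, Y t ω)))
    (Q : Kernel 𝒳 𝒳) (V : Set 𝒳) (hA : ConditionA κ Q P X V)
    (π : Measure 𝒳) [IsProbabilityMeasure π] (hπ : Kernel.Invariant Q π)
    (L : ∀ i, 𝒴 i → ℝ) (hL_meas : ∀ i, Measurable (L i)) (hL_nonneg : ∀ i y, 0 ≤ L i y)
    (hB : ConditionBHat P X Y π L) :
    ConditionB3 P Y V L := by
  intro i
  obtain ⟨h, φ, F, hD⟩ := hB i
  have hX : ∀ t, Measurable (X t) := fun t => measurable_fst.comp (hZ.measurable t)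
  have hLi : Measurable fun z : 𝒳 × (∀ i, 𝒴 i) => L i (z.2 i) :=
    (hL_meas i).comp ((measurable_pi_apply i).comp measurable_snd)
  have hℓm : ∀ t, Measurable fun ω => L i (Y t ω i) := fun t => hLi.comp (hZ.measurable t)
  have hstart : ∀ x y, ∀ᵐ ω ∂(P (x, y)), L i (Y 0 ω i) = L i (y i) := by
    intro x y
    refine ae_of_ae_map (p := fun z : 𝒳 × (∀ i, 𝒴 i) => L i (z.2 i) = L i (y i))
      (hZ.measurable 0).aemeasurable ?_
    rw [hZ.start (x, y)]
    exact (ae_dirac_iff (hLi (measurableSet_singleton _))).2 rfl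
  have hint : ∀ x y t, Integrable (fun ω => L i (Y t ω i)) (P (x, y)) := by
    intro x y t
    have := hZ.isProbability (x, y)
    refine hD.integrable hX (fun t ω => hL_nonneg i _) hℓm (x, y) ?_ t
    exact (integrable_const (L i (y i))).congr ((hstart x y).mono fun ω hω => hω.symm)
  refine ⟨fun x _ y t => hint x y t, ?_⟩
  obtain ⟨x₀⟩ : Nonempty 𝒳 := π.nonempty_of_neZero
  have hne : Nonempty 𝒳 := ⟨x₀⟩
  set z₀ : 𝒳 × (∀ i, 𝒴 i) := (x₀, Classical.arbitrary _)
  have := hZ.isProbability z₀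
  have hQ : IsMarkovKernel Q := isMarkovKernel_of_autonomous hA.autonomous
  have hK := hD.isMarkovKernel z₀
  obtain ⟨μ, p, C, m, hμ, H⟩ := hA.exists_isPetiteRecurrent hZ
  refine tendsto_iSup_div_zero
    (f := fun x y t => ∫ ω, (L i (Y t ω i) - L i (y i)) ∂(P (x, y))) (hA.nonempty hZ) ?_ ?_
  · intro x y
    have := hZ.isProbability (x, y)
    -- Non-negativity of the test function is the whole lower bound.
    refine ⟨-L i (y i), fun t => ?_⟩
    rw [integral_sub (hint x y t) (integrable_const _), integral_const, probReal_univ, one_smul]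
    have : 0 ≤ ∫ ω, L i (Y t ω i) ∂(P (x, y)) := integral_nonneg fun ω => hL_nonneg i (Y t ω i)
    linarith
  · intro ε hε
    obtain ⟨B, hB⟩ := H.integral_sub_start_le (Ω := Ω) (K := hD.kernel z₀) hπ
      (hD.hasUniformTails z₀) hD.drift_neg hD.h_nonneg hD.h_antitone hD.h_tendsto hε
    refine ⟨B, fun x hx y t => ?_⟩
    have := hZ.isProbability (x, y)
    refine le_trans (le_of_eq (integral_congr_ae ?_)) (hB (P (x, y)) _ _ X _
      (fun t ω => L i (Y t ω i)) x hx (hZ.isChainFrom hA.autonomous x y)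
      (hD.isSampledFrom hX z₀ (x, y)) (fun t ω => hL_nonneg i _) (hint x y)
      (hD.increment_le (x, y)) t)
    filter_upwards [hstart x y] with ω hω
    rw [hω]
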